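/- Let $m,n\ge 1$ and $r\ge 0$ be integers, let $a_0,a_1,\dots,a_r\in M_m(\mathbb C)$ be self-adjoint matrices, and let $X_1^{(n)},\dots,X_r^{(n)}$ be independent random matrices from the class $\mathrm{SGRM}(n,\frac1n)$: each $X=X_i^{(n)}$ is a random self-adjoint complex $n\times n$ matrix for which $(X_{kk})_{k}$, $(\sqrt2\,\mathrm{Re}\,X_{kl})_{k<l}$, $(\sqrt2\,\mathrm{Im}\,X_{kl})_{k<l}$ are $n^2$ independent Gaussian random variables with mean $0$ and variance $\frac1n$. Put $$S_n=a_0\otimes 1_n+\sum_{i=1}^r a_i\otimes X_i^{(n)}\in M_m(\mathbb C)\otimes M_n(\mathbb C).$$ Let $\lambda\in M_m(\mathbb C)$ be such that $\mathrm{Im}\,\lambda=\frac1{2\mathrm i}(\lambda-\lambda^*)$ is positive definite. Then $\lambda\otimes 1_n-S_n$ is invertible at every sample point, the $M_m(\mathbb C)$-valued random variable $$H_n(\lambda)=(\mathrm{id}_m\otimes \mathrm{tr}_n)\big[(\lambda\otimes 1_n-S_n)^{-1}\big],$$ where $\mathrm{tr}_n=\frac1n\mathrm{Tr}_n$ is the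 normalized trace, is integrable, and $G_n(\lambda)=\mathbb E\{H_n(\lambda)\}\in M_m(\mathbb C)$ satisfies $$\Big\|\sum_{i=1}^r a_iG_n(\lambda)a_iG_n(\lambda)+(a_0-\lambda)G_n(\lambda)+1_m\Big\|\le\frac{C}{n^2}\big\|(\mathrm{Im}\,\lambda)^{-1}\big\|^4,\qquad C=m^3\Big\|\sum_{i=1}^r a_i^2\Big\|^2,$$ where $\|\cdot\|$ denotes the operator norm on $M_m(\mathbb C)$. -/

import Mathlib

open MeasureTheory ProbabilityTheory
open scoped NNReal Matrix Kronecker ComplexOrder Matrix.Norms.L2Operator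

namespace MasterInequality

/-- The product σ-algebra on a space of complex matrices; it makes a matrix-valued map
measurable exactly when all its entries are measurable. -/
noncomputable instance instMeasurableSpaceMatrix {ι κ : Type*} : MeasurableSpace (Matrix ι κ ℂ) :=
  (inferInstance : MeasurableSpace (ι → κ → ℂ))

/-- The `n ^ 2` real coordinates of a self-adjoint matrix `A`, indexed by the pairs `(k, l)`:
`A k k` on the diagonal, `√2 Re (A k l)` at `(k, l)` with `k < l`, and
`√2 Im (A k l)` (again with `k < l`) at the transposed position `(l, k)`. -/
noncomputable def saCoord {n : ℕ} (A : Matrix (Fin n) (Fin n) ℂ) (p : Fin n × Fin n) : ℝ :=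
  if p.1 = p.2 then (A p.1 p.1).re
  else if p.1 < p.2 then √2 * (A p.1 p.2).re
  else √2 * (A p.2 p.1).im

/-- The class `SGRM(n, v)`: random self-adjoint `n × n` matrices `X` for which `(X k k)`,
`(√2 Re X k l)` for `k < l` and `(√2 Im X k l)` for `k < l` are `n ^ 2` independent Gaussian
random variables with mean `0` and variance `v`. -/
structure IsSGRM {Ω : Type*} [MeasurableSpace Ω] (P : Measure Ω) (n : ℕ) (v : ℝ≥0)
    (X : Ω → Matrix (Fin n) (Fin n) ℂ) : Prop where
  measurable : Measurable X
  isHermitian : ∀ ω, (X ω).IsHermitian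
  iIndepFun_coord : iIndepFun (fun (p : Fin n × Fin n) (ω : Ω) => saCoord (X ω) p) P
  hasLaw_coord : ∀ p : Fin n × Fin n, HasLaw (fun ω => saCoord (X ω) p) (gaussianReal 0 v) P

/-- The imaginary part `(T - T*) / (2i)` of a square matrix. -/
noncomputable def imPart {m : ℕ} (T : Matrix (Fin m) (Fin m) ℂ) : Matrix (Fin m) (Fin m) ℂ :=
  (1 / (2 * Complex.I)) • (T - Tᴴ)

/-- The map `id_m ⊗ tr_n` from `M_m(ℂ) ⊗ M_n(ℂ)` to `M_m(ℂ)`, where `tr_n` is the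
normalized trace. -/
noncomputable def idTensorTr {m n : ℕ} (T : Matrix (Fin m × Fin n) (Fin m × Fin n) ℂ) :
    Matrix (Fin m) (Fin m) ℂ :=
  Matrix.of fun j k => (1 / (n : ℂ)) * ∑ u : Fin n, T (j, u) (k, u)

/-- `S_n = a₀ ⊗ 1_n + ∑ i, a_i ⊗ x_i`. -/
noncomputable def linPencil {m n r : ℕ} (a₀ : Matrix (Fin m) (Fin m) ℂ)
    (a : Fin r → Matrix (Fin m) (Fin m) ℂ) (x : Fin r → Matrix (Fin n) (Fin n) ℂ) :
    Matrix (Fin m × Fin n) (Fin m × Fin n) ℂ :=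
  a₀ ⊗ₖ (1 : Matrix (Fin n) (Fin n) ℂ) + ∑ i, a i ⊗ₖ x i

/-- `H_n(z) = (id_m ⊗ tr_n) [(z ⊗ 1_n - S_n)⁻¹]`. -/
noncomputable def resolventTr {m n r : ℕ} (a₀ : Matrix (Fin m) (Fin m) ℂ)
    (a : Fin r → Matrix (Fin m) (Fin m) ℂ) (z : Matrix (Fin m) (Fin m) ℂ)
    (x : Fin r → Matrix (Fin n) (Fin n) ℂ) : Matrix (Fin m) (Fin m) ℂ :=
  idTensorTr ((z ⊗ₖ (1 : Matrix (Fin n) (Fin n) ℂ) - linPencil a₀ a x)⁻¹)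

/-- `G_n(z) = 𝔼 {H_n(z)}`, an expectation with values in `M_m(ℂ)`. -/
noncomputable def meanResolventTr {Ω : Type*} [MeasurableSpace Ω] (P : Measure Ω) {m n r : ℕ}
    (a₀ : Matrix (Fin m) (Fin m) ℂ) (a : Fin r → Matrix (Fin m) (Fin m) ℂ)
    (X : Fin r → Ω → Matrix (Fin n) (Fin n) ℂ) (z : Matrix (Fin m) (Fin m) ℂ) :
    Matrix (Fin m) (Fin m) ℂ :=
  ∫ ω, resolventTr a₀ a z (fun i => X i ω) ∂P

end MasterInequality

/-! Write `R = (z ⊗ 1 - S)⁻¹`, `H = (id ⊗ tr) R` and `G = 𝔼 H`. Since `S` is self-adjoint and `Im z`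
is positive definite, `R` exists and has norm at most `c = ‖(Im z)⁻¹‖`
(`isUnit_and_norm_resolvent_le`). In the orthonormal coordinates `y t` of the matrices `X i`, with
basis matrices `B t = a i ⊗ saBasis p`, everything becomes a smooth bounded function of independent
Gaussians of variance `1/n`.

The resolvent identity reads `((z - a₀) ⊗ 1) R - 1 = ∑ t, y t • B t R`. Gaussian integration by
parts replaces `y t` by `1/n` times the derivative `R B t R` of `R`, and completeness of the basis
collapses the sum over `p` to `n (a i H a i) ⊗ 1`. After the partial trace this gives the exact
equation `𝔼 [(z - a₀) H - ∑ a i H a i H - 1] = 0` (`integral_master_eq_zero`).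

Replacing `H` by its mean in the quadratic term costs exactly a covariance: the matrix to be bounded
equals `-𝔼 ∑ a i (H - G) a i (H - G)`. With `N = ‖∑ a i ^ 2‖`, its norm is at most `N` times the sum
of the variances of the `m ^ 2` entries of `H` (`norm_sum_mul_mul_le`, `l2_opNorm_sq_le_frobSq`).

Each variance is at most `m N c ^ 4 / n ^ 2` (`integral_norm_idTensorTr_sub_sq_le`). This is the
Gaussian Poincaré inequality together with a Bessel inequality for the gradient; the Poincaré
inequality itself comes from its one-dimensional case by Efron–Stein. Altogether the bound is `N * m
^ 2 * (m N c ^ 4 / n ^ 2)`, which is the constant claimed. -/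

namespace MasterInequality

/-! ### Efron–Stein inequality by exchanging coordinates with an independent copy -/

section EfronStein

variable {ι α : Type*} [Fintype ι] [DecidableEq ι] [MeasurableSpace α]

/-- Exchange the coordinates in `S` of two points of a product space. -/
def swapOn (S : Finset ι) (z : (ι → α) × (ι → α)) : (ι → α) × (ι → α) :=
  (S.piecewise z.2 z.1, S.piecewise z.1 z.2)

/-- A pair of points of the product is a family of pairs, on which the exchange acts coordinatewise
by `Prod.swap` or `id`; both preserve `(μ i).prod (μ i)`. -/
lemma measurePreserving_swapOn (μ : ι → Measure α) [∀ i, IsProbabilityMeasure (μ i)]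
    (S : Finset ι) :
    MeasurePreserving (swapOn S) ((Measure.pi μ).prod (Measure.pi μ))
      ((Measure.pi μ).prod (Measure.pi μ)) := by
  have h1 := measurePreserving_arrowProdEquivProdArrow α α ι μ μ
  have h2 : MeasurePreserving (fun (a : ι → α × α) i => (if i ∈ S then Prod.swap else id) (a i))
      (Measure.pi fun i => (μ i).prod (μ i)) (Measure.pi fun i => (μ i).prod (μ i)) := by
    refine measurePreserving_pi (fun i => (μ i).prod (μ i)) (fun i => (μ i).prod (μ i))
      (f := fun i => if i ∈ S then Prod.swap else id) fun i => ?_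
    split_ifs
    · exact Measure.measurePreserving_swap
    · exact MeasurePreserving.id _
  convert h1.comp (h2.comp (h1.symm _)) using 1
  ext z i
  · by_cases hi : i ∈ S <;>
      simp [swapOn, MeasurableEquiv.arrowProdEquivProdArrow, Equiv.arrowProdEquivProdArrow, hi]
  · by_cases hi : i ∈ S <;>
      simp [swapOn, MeasurableEquiv.arrowProdEquivProdArrow, Equiv.arrowProdEquivProdArrow, hi]

/-- Resampling one coordinate keeps the law, being the first component of the exchange on `{i}`. It
lets one-dimensional facts be applied in a single coordinate. -/
lemma measurePreserving_update (μ : ι → Measure α) [∀ i, IsProbabilityMeasure (μ i)] (i : ι) :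
    MeasurePreserving (fun z : (ι → α) × α => Function.update z.1 i z.2)
      ((Measure.pi μ).prod (μ i)) (Measure.pi μ) := by
  have hm : Measurable fun z : (ι → α) × α => Function.update z.1 i z.2 := by
    refine measurable_pi_iff.2 fun j => ?_
    by_cases h : j = i
    · subst h; simpa using measurable_snd
    · simpa [h, Function.comp_def] using (measurable_pi_apply j).comp measurable_fst
  have h1 : MeasurePreserving (Prod.map id (Function.eval i))
      ((Measure.pi μ).prod (Measure.pi μ)) ((Measure.pi μ).prod (μ i)) :=
    (MeasurePreserving.id _).prod (measurePreserving_eval μ i)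
  have h2 : MeasurePreserving (fun z => (swapOn {i} z).1)
      ((Measure.pi μ).prod (Measure.pi μ)) (Measure.pi μ) :=
    measurePreserving_fst.comp (measurePreserving_swapOn μ {i})
  refine ⟨hm, ?_⟩
  rw [← h1.map_eq, Measure.map_map hm h1.measurable]
  refine Eq.trans ?_ h2.map_eq
  congr 1
  ext z j
  by_cases h : j = i
  · subst h; simp [swapOn]
  · simp [swapOn, h]

variable {E : Type*} [NormedAddCommGroup E] [InnerProductSpace ℝ E]

/-- The Efron–Stein inequality, with variances written through an independent copy. -/
lemma integral_norm_sub_sq_le_sum (μ : ι → Measure α) [∀ i, IsProbabilityMeasure (μ i)]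
    {f : (ι → α) → E} (hf : StronglyMeasurable f) {C : ℝ} (hC : ∀ x, ‖f x‖ ≤ C) :
    ∫ z, ‖f z.1 - f z.2‖ ^ 2 ∂((Measure.pi μ).prod (Measure.pi μ)) ≤
      ∑ i, ∫ z, ‖f z.1 - f (Function.update z.1 i (z.2 i))‖ ^ 2
        ∂((Measure.pi μ).prod (Measure.pi μ)) := by
  set ρ := (Measure.pi μ).prod (Measure.pi μ) with hρ
  have hmeas : ∀ S : Finset ι, StronglyMeasurable fun z : (ι → α) × (ι → α) =>
      f (swapOn S z).1 := fun S =>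
    hf.comp_measurable (measurable_fst.comp (measurePreserving_swapOn μ S).measurable)
  have hsw0 : ∀ z : (ι → α) × (ι → α), (swapOn ∅ z).1 = z.1 := fun z => by simp [swapOn]
  have hsw1 : ∀ z : (ι → α) × (ι → α), (swapOn Finset.univ z).1 = z.2 := fun z => by
    simp [swapOn]
  have hup : ∀ i, ∀ z : (ι → α) × (ι → α),
      (swapOn {i} z).1 = Function.update z.1 i (z.2 i) := fun i z => by
    ext j
    by_cases h : j = i
    · subst h; simp [swapOn]
    · simp [swapOn, h]
  have hint : ∀ S T U V : Finset ι, Integrable (fun z : (ι → α) × (ι → α) =>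
      inner ℝ (f (swapOn S z).1 - f (swapOn T z).1) (f (swapOn U z).1 - f (swapOn V z).1)) ρ := by
    intro S T U V
    refine Integrable.of_bound (C := (C + C) * (C + C))
      (((hmeas S).sub (hmeas T)).inner ((hmeas U).sub (hmeas V))).aestronglyMeasurable
      (.of_forall fun z => ?_)
    refine (norm_inner_le_norm _ _).trans ?_
    have : ∀ x y, ‖f x - f y‖ ≤ C + C := fun x y =>
      (norm_sub_le _ _).trans (add_le_add (hC x) (hC y))
    have h0 : 0 ≤ C + C := (norm_nonneg _).trans (this z.1 z.1)
    gcongr <;> exact this _ _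
  have hint0 : ∀ S U V : Finset ι, Integrable (fun z : (ι → α) × (ι → α) =>
      inner ℝ (f (swapOn S z).1) (f (swapOn U z).1 - f (swapOn V z).1)) ρ := by
    intro S U V
    refine Integrable.of_bound (C := C * (C + C))
      ((hmeas S).inner ((hmeas U).sub (hmeas V))).aestronglyMeasurable
      (.of_forall fun z => ?_)
    refine (norm_inner_le_norm _ _).trans ?_
    have : ∀ x y, ‖f x - f y‖ ≤ C + C := fun x y =>
      (norm_sub_le _ _).trans (add_le_add (hC x) (hC y))
    have h0 : 0 ≤ C := (norm_nonneg _).trans (hC z.1)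
    gcongr
    · exact hC _
    · exact this _ _
  have hcomp : ∀ (S : Finset ι) (F : (ι → α) × (ι → α) → ℝ), StronglyMeasurable F →
      ∫ z, F (swapOn S z) ∂ρ = ∫ z, F z ∂ρ := fun S F hF => by
    have h := measurePreserving_swapOn μ S
    conv_rhs => rw [hρ, ← h.map_eq]
    rw [integral_map h.measurable.aemeasurable hF.aestronglyMeasurable]
  -- Telescoping over the exchanged coordinates: enlarging `S` by `i` costs at most the effect of
  -- resampling coordinate `i` alone.
  have key : ∀ S : Finset ι, 2 * ∫ z, inner ℝ (f z.1) (f z.1 - f (swapOn S z).1) ∂ρ ≤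
      ∑ i ∈ S, ∫ z, ‖f z.1 - f (swapOn {i} z).1‖ ^ 2 ∂ρ := by
    intro S
    induction S using Finset.induction_on with
    | empty => simp [swapOn]
    | insert i S hi ih =>
      rw [Finset.sum_insert hi]
      have hs1 : ∀ z : (ι → α) × (ι → α), (swapOn S (swapOn {i} z)).1 =
          (swapOn (insert i S) z).1 := fun z => by
        ext j
        by_cases hj : j = i
        · subst hj; simp [swapOn, hi]
        · by_cases hS : j ∈ S <;> simp [swapOn, hj, hS]
      have hs2 : ∀ z : (ι → α) × (ι → α), (swapOn (insert i S) (swapOn {i} z)).1 =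
          (swapOn S z).1 := fun z => by
        ext j
        by_cases hj : j = i
        · subst hj; simp [swapOn, hi]
        · by_cases hS : j ∈ S <;> simp [swapOn, hj, hS]
      have hs3 : ∀ z : (ι → α) × (ι → α), (swapOn {i} (swapOn S z)).1 =
          (swapOn (insert i S) z).1 := fun z => by
        ext j
        by_cases hj : j = i
        · subst hj; simp [swapOn, hi]
        · by_cases hS : j ∈ S <;> simp [swapOn, hj, hS]
      have e1 : ∫ z, inner ℝ (f z.1) (f z.1 - f (swapOn (insert i S) z).1) ∂ρ =
          ∫ z, inner ℝ (f z.1) (f z.1 - f (swapOn S z).1) ∂ρ +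
          ∫ z, inner ℝ (f z.1) (f (swapOn S z).1 - f (swapOn (insert i S) z).1) ∂ρ := by
        rw [← integral_add]
        · simp_rw [← inner_add_right, sub_add_sub_cancel]
        · simpa only [hsw0] using hint0 ∅ ∅ S
        · simpa only [hsw0] using hint0 ∅ S (insert i S)
      -- Exchanging coordinate `i` interchanges the two terms of the increment, so averaging the two
      -- expressions produces a difference in the first slot as well (`e3`). By `e4` both
      -- differences have the same second moment, and `e5` is then the inequality between the
      -- product and half the sum of squares.
      have e2 : ∫ z, inner ℝ (f z.1) (f (swapOn S z).1 - f (swapOn (insert i S) z).1) ∂ρ =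
          ∫ z, inner ℝ (f (swapOn {i} z).1)
            (f (swapOn (insert i S) z).1 - f (swapOn S z).1) ∂ρ := by
        rw [← hcomp {i}]
        · simp only [hs1, hs2]
        · exact (hf.comp_measurable measurable_fst).inner ((hmeas S).sub (hmeas (insert i S)))
      have e3 : 2 * ∫ z, inner ℝ (f z.1) (f (swapOn S z).1 - f (swapOn (insert i S) z).1) ∂ρ =
          ∫ z, inner ℝ (f z.1 - f (swapOn {i} z).1)
            (f (swapOn S z).1 - f (swapOn (insert i S) z).1) ∂ρ := by
        rw [two_mul]
        nth_rewrite 2 [e2]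
        rw [← integral_add]
        · congr 1
          ext z
          rw [← neg_sub (f (swapOn S z).1), inner_neg_right, inner_sub_left]
          ring
        · simpa only [hsw0] using hint0 ∅ S (insert i S)
        · exact hint0 {i} (insert i S) S
      have hsq : ∀ U V, Integrable (fun z => ‖f (swapOn U z).1 - f (swapOn V z).1‖ ^ 2) ρ := by
        intro U V
        simpa only [real_inner_self_eq_norm_sq] using hint U V U V
      have e4 : ∫ z, ‖f (swapOn S z).1 - f (swapOn (insert i S) z).1‖ ^ 2 ∂ρ =
          ∫ z, ‖f z.1 - f (swapOn {i} z).1‖ ^ 2 ∂ρ := by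
        have := hcomp S (fun z => ‖f z.1 - f (swapOn {i} z).1‖ ^ 2)
          (((hf.comp_measurable measurable_fst).sub (hmeas {i})).norm.pow 2)
        simpa only [hs3] using this
      have e5 : ∫ z, inner ℝ (f z.1 - f (swapOn {i} z).1)
            (f (swapOn S z).1 - f (swapOn (insert i S) z).1) ∂ρ ≤
          ∫ z, ‖f z.1 - f (swapOn {i} z).1‖ ^ 2 ∂ρ := by
        calc _ ≤ ∫ z, (‖f z.1 - f (swapOn {i} z).1‖ ^ 2 / 2 +
              ‖f (swapOn S z).1 - f (swapOn (insert i S) z).1‖ ^ 2 / 2) ∂ρ := by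
              refine integral_mono ?_ ?_ fun z => ?_
              · simpa only [hsw0] using hint ∅ {i} S (insert i S)
              · refine (Integrable.div_const ?_ _).add ((hsq _ _).div_const _)
                simpa only [hsw0] using hsq ∅ {i}
              · refine (real_inner_le_norm _ _).trans ?_
                nlinarith [sq_nonneg (‖f z.1 - f (swapOn {i} z).1‖ -
                  ‖f (swapOn S z).1 - f (swapOn (insert i S) z).1‖)]
          _ = _ := by
              rw [integral_add, integral_div, integral_div, e4]
              · ring
              · refine Integrable.div_const ?_ _
                simpa only [hsw0] using hsq ∅ {i}
              · exact (hsq _ _).div_const _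
      rw [e1, mul_add, e3, add_comm]
      exact add_le_add e5 ih
  have h := key Finset.univ
  simp only [hsw1, hup] at h
  refine le_trans (le_of_eq ?_) h
  -- With all coordinates exchanged, symmetry between the two copies turns twice the inner product
  -- into the squared distance.
  have e2 : ∫ z, inner ℝ (f z.1) (f z.1 - f z.2) ∂ρ = ∫ z, inner ℝ (f z.2) (f z.2 - f z.1) ∂ρ := by
    rw [← hcomp Finset.univ]
    · simp [swapOn]
    · exact (hf.comp_measurable measurable_fst).inner
        ((hf.comp_measurable measurable_fst).sub (hf.comp_measurable measurable_snd))
  rw [two_mul]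
  nth_rewrite 2 [e2]
  rw [← integral_add]
  · congr 1
    ext z
    rw [← neg_sub (f z.1), inner_neg_right, ← real_inner_self_eq_norm_sq, inner_sub_left]
    ring
  · simpa only [hsw0, hsw1] using hint0 ∅ ∅ Finset.univ
  · simpa only [hsw0, hsw1] using hint0 Finset.univ Finset.univ ∅

/-- The variance of a bounded function, in terms of an independent copy. -/
lemma integral_norm_sub_integral_sq {β : Type*} [MeasurableSpace β] (μ : Measure β)
    [IsProbabilityMeasure μ] [CompleteSpace E]
    {f : β → E} (hf : StronglyMeasurable f) {C : ℝ} (hC : ∀ x, ‖f x‖ ≤ C) :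
    ∫ z, ‖f z.1 - f z.2‖ ^ 2 ∂(μ.prod μ) = 2 * ∫ x, ‖f x - ∫ y, f y ∂μ‖ ^ 2 ∂μ := by
  set m := ∫ y, f y ∂μ with hm
  have hfi : Integrable f μ := .of_bound hf.aestronglyMeasurable C (.of_forall hC)
  have hgi : Integrable (fun x => f x - m) μ := hfi.sub (integrable_const _)
  have hg0 : ∫ x, (f x - m) ∂μ = 0 := by
    rw [integral_sub hfi (integrable_const _)]; simp [hm]
  have hsq : Integrable (fun x => ‖f x - m‖ ^ 2) μ := by
    refine .of_bound ((hf.sub stronglyMeasurable_const).norm.pow 2).aestronglyMeasurable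
      ((C + ‖m‖) ^ 2) (.of_forall fun x => ?_)
    rw [Real.norm_of_nonneg (by positivity)]
    gcongr
    exact (norm_sub_le _ _).trans (by gcongr; exact hC x)
  have hinner : Integrable (fun z : β × β => inner ℝ (f z.1 - m) (f z.2 - m)) (μ.prod μ) := by
    refine .of_bound (((hf.sub stronglyMeasurable_const).comp_measurable measurable_fst).inner
      ((hf.sub stronglyMeasurable_const).comp_measurable measurable_snd)).aestronglyMeasurable
      ((C + ‖m‖) * (C + ‖m‖)) (.of_forall fun z => (norm_inner_le_norm _ _).trans ?_)
    have : ∀ x, ‖f x - m‖ ≤ C + ‖m‖ := fun x => (norm_sub_le _ _).trans (by gcongr; exact hC x)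
    have h0 := (norm_nonneg _).trans (this z.1)
    gcongr <;> exact this _
  have h1 : Integrable (fun z : β × β => ‖f z.1 - m‖ ^ 2) (μ.prod μ) := hsq.comp_fst μ
  have h2 : Integrable (fun z : β × β => ‖f z.2 - m‖ ^ 2) (μ.prod μ) := hsq.comp_snd μ
  have : ∀ z : β × β, ‖f z.1 - f z.2‖ ^ 2 =
      ‖f z.1 - m‖ ^ 2 - 2 * inner ℝ (f z.1 - m) (f z.2 - m) + ‖f z.2 - m‖ ^ 2 := fun z => by
    rw [← norm_sub_sq_real, sub_sub_sub_cancel_right]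
  simp_rw [this]
  rw [integral_add (f := fun z : β × β => ‖f z.1 - m‖ ^ 2 - 2 * inner ℝ (f z.1 - m) (f z.2 - m))
    (h1.sub (hinner.const_mul 2)) h2, integral_sub h1 (hinner.const_mul 2),
    integral_const_mul, integral_prod _ hinner]
  simp_rw [integral_inner hgi, hg0]
  rw [integral_fun_fst (fun x => ‖f x - m‖ ^ 2), integral_fun_snd (fun x => ‖f x - m‖ ^ 2)]
  simp
  ring

end EfronStein

/-! ### One-dimensional Gaussian: integration by parts and Poincaré inequality -/

section GaussianReal

open Set Filter Topology ENNReal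

lemma hasDerivAt_gaussianPDFReal {v : ℝ≥0} (hv : v ≠ 0) (x : ℝ) :
    HasDerivAt (gaussianPDFReal 0 v) (-(x / v) * gaussianPDFReal 0 v x) x := by
  have hv' : (v : ℝ) ≠ 0 := by exact_mod_cast hv
  have h1 : HasDerivAt (fun x : ℝ => -(x - 0) ^ 2 / (2 * v)) (-(x / v)) x := by
    have := (((hasDerivAt_id x).sub_const 0).pow 2).neg.div_const (2 * (v : ℝ))
    refine this.congr_deriv ?_
    simp only [id, Nat.cast_ofNat, sub_zero, Nat.add_one_sub_one, pow_one]
    field_simp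
  have h2 := h1.exp.const_mul (√(2 * Real.pi * v))⁻¹
  rw [gaussianPDFReal_def]
  exact h2.congr_deriv (by ring)

lemma continuous_gaussianPDFReal (v : ℝ≥0) : Continuous (gaussianPDFReal 0 v) := by
  rw [gaussianPDFReal_def]
  fun_prop

lemma tendsto_gaussianPDFReal_atTop {v : ℝ≥0} (hv : v ≠ 0) :
    Tendsto (gaussianPDFReal 0 v) atTop (𝓝 0) := by
  have hv' : 0 < (v : ℝ) := by exact_mod_cast pos_iff_ne_zero.2 hv
  rw [gaussianPDFReal_def]
  have h : Tendsto (fun x : ℝ => -(x - 0) ^ 2 / (2 * v)) atTop atBot := by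
    simp only [sub_zero, neg_div]
    exact tendsto_neg_atTop_atBot.comp
      ((tendsto_pow_atTop two_ne_zero).atTop_div_const (by positivity))
  simpa using (Real.tendsto_exp_atBot.comp h).const_mul (√(2 * Real.pi * v))⁻¹

lemma integrable_smul_gaussianReal {E : Type*} [NormedAddCommGroup E] [NormedSpace ℝ E]
    (v : ℝ≥0) {f : ℝ → E} (hf : Continuous f) {C : ℝ} (hC : ∀ x, ‖f x‖ ≤ C) :
    Integrable (fun x => x • f x) (gaussianReal 0 v) := by
  have h : Integrable (fun x : ℝ => x) (gaussianReal 0 v) :=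
    (memLp_id_gaussianReal 1).integrable le_rfl
  exact h.smul_bdd C (hf.aestronglyMeasurable) (.of_forall hC)

lemma integrable_gaussianReal_iff {E : Type*} [NormedAddCommGroup E] [NormedSpace ℝ E]
    {v : ℝ≥0} (hv : v ≠ 0) {f : ℝ → E} :
    Integrable f (gaussianReal 0 v) ↔ Integrable fun x => gaussianPDFReal 0 v x • f x := by
  rw [gaussianReal_of_var_ne_zero _ hv, integrable_withDensity_iff_integrable_smul'
    (measurable_gaussianPDF 0 v) (.of_forall fun x => gaussianPDF_lt_top)]
  simp only [toReal_gaussianPDF]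

/-- Gaussian integration by parts (Stein's identity) on the real line. -/
lemma integral_smul_gaussianReal {E : Type*} [NormedAddCommGroup E] [NormedSpace ℝ E]
    [CompleteSpace E] {v : ℝ≥0} (hv : v ≠ 0) {f f' : ℝ → E} (hf : ∀ x, HasDerivAt f (f' x) x)
    (hf' : Continuous f') {C C' : ℝ} (hC : ∀ x, ‖f x‖ ≤ C) (hC' : ∀ x, ‖f' x‖ ≤ C') :
    ∫ x, x • f x ∂(gaussianReal 0 v) = (v : ℝ) • ∫ x, f' x ∂(gaussianReal 0 v) := by
  have hv' : (v : ℝ) ≠ 0 := by exact_mod_cast hv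
  have hfc : Continuous f := continuous_iff_continuousAt.2 fun x => (hf x).continuousAt
  have i1 : Integrable f (gaussianReal 0 v) :=
    .of_bound hfc.aestronglyMeasurable C (.of_forall hC)
  have i2 : Integrable f' (gaussianReal 0 v) :=
    .of_bound hf'.aestronglyMeasurable C' (.of_forall hC')
  have i3 := integrable_smul_gaussianReal v hfc hC
  rw [integrable_gaussianReal_iff hv] at i1 i2 i3
  have e : ∀ x : ℝ, (-(x / v) * gaussianPDFReal 0 v x) • f x =
      (-(v : ℝ)⁻¹) • (gaussianPDFReal 0 v x • x • f x) := fun x => by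
    simp only [smul_smul]; congr 1; field_simp
  have := integral_bilinear_hasDerivAt_right_eq_neg_left_of_integrable
    (L := ContinuousLinearMap.lsmul ℝ ℝ (E := E)) (u := gaussianPDFReal 0 v) (v := f)
    (u' := fun x => -(x / v) * gaussianPDFReal 0 v x) (v' := f')
    (fun x _ => hasDerivAt_gaussianPDFReal hv x) (fun x _ => hf x) i2
    (by
      simp only [ContinuousLinearMap.lsmul_apply, e]
      exact i3.smul (-(v : ℝ)⁻¹)) i1
  simp only [ContinuousLinearMap.lsmul_apply, e] at this
  rw [integral_smul] at this
  rw [integral_gaussianReal_eq_integral_smul hv, integral_gaussianReal_eq_integral_smul hv, this]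
  simp [smul_smul, hv']

/-- The density `φ` satisfies `x φ(x) = (-v φ)'(x)` and vanishes at infinity. -/
lemma setIntegral_Ici_id_gaussianReal {v : ℝ≥0} (hv : v ≠ 0) (s : ℝ) :
    ∫ x in Ici s, x ∂(gaussianReal 0 v) = v * gaussianPDFReal 0 v s := by
  have hv' : (v : ℝ) ≠ 0 := by exact_mod_cast hv
  have hi : Integrable (fun x : ℝ => x) (gaussianReal 0 v) :=
    (memLp_id_gaussianReal 1).integrable le_rfl
  rw [integrable_gaussianReal_iff hv] at hi
  rw [← integral_indicator measurableSet_Ici, integral_gaussianReal_eq_integral_smul hv]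
  have : (fun x => gaussianPDFReal 0 v x • (Ici s).indicator (fun x : ℝ => x) x) =
      (Ici s).indicator fun x => gaussianPDFReal 0 v x • x := by
    ext x; by_cases h : x ∈ Ici s <;> simp [h]
  rw [this, integral_indicator measurableSet_Ici, integral_Ici_eq_integral_Ioi]
  have h := integral_Ioi_of_hasDerivAt_of_tendsto (a := s) (m := 0)
    (f := fun x => -(v : ℝ) * gaussianPDFReal 0 v x) (f' := fun x => gaussianPDFReal 0 v x • x)
    (by have := continuous_gaussianPDFReal v; fun_prop)
    (fun x _ => ((hasDerivAt_gaussianPDFReal hv x).const_mul (-(v : ℝ))).congr_deriv (by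
      rw [smul_eq_mul]; field_simp))
    hi.integrableOn (by simpa using (tendsto_gaussianPDFReal_atTop hv).const_mul (-(v : ℝ)))
  rw [h]; ring

lemma setIntegral_Iio_id_gaussianReal {v : ℝ≥0} (hv : v ≠ 0) (s : ℝ) :
    ∫ x in Iio s, x ∂(gaussianReal 0 v) = -(v * gaussianPDFReal 0 v s) := by
  have hi : Integrable (fun x : ℝ => x) (gaussianReal 0 v) :=
    (memLp_id_gaussianReal 1).integrable le_rfl
  have h := integral_add_compl (measurableSet_Iio (a := s)) hi
  rw [compl_Iio, setIntegral_Ici_id_gaussianReal hv, integral_id_gaussianReal] at h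
  linarith

/-- The kernel of the one-dimensional Gaussian Poincaré inequality. -/
lemma lintegral_Ici_lintegral_Iio_sub_gaussianReal {v : ℝ≥0} (hv : v ≠ 0) (s : ℝ) :
    ∫⁻ x in Ici s, ∫⁻ y in Iio s, ENNReal.ofReal (x - y) ∂(gaussianReal 0 v)
      ∂(gaussianReal 0 v) = ENNReal.ofReal (v * gaussianPDFReal 0 v s) := by
  have hφ : 0 ≤ v * gaussianPDFReal 0 v s :=
    mul_nonneg v.2 (gaussianPDFReal_nonneg _ _ _)
  have hi : Integrable (fun x : ℝ => x) (gaussianReal 0 v) :=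
    (memLp_id_gaussianReal 1).integrable le_rfl
  have h1 : ∀ x ∈ Ici s, ∫⁻ y in Iio s, ENNReal.ofReal (x - y) ∂(gaussianReal 0 v) =
      ENNReal.ofReal ((gaussianReal 0 v).real (Iio s) * x + v * gaussianPDFReal 0 v s) := by
    intro x hx
    rw [← ofReal_integral_eq_lintegral_ofReal]
    · rw [integral_sub (integrable_const _) hi.integrableOn, setIntegral_Iio_id_gaussianReal hv]
      simp [measureReal_def]
    · exact (integrable_const _).sub hi.integrableOn
    · refine (ae_restrict_iff' measurableSet_Iio).2 (.of_forall fun y hy => ?_)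
      simp only [mem_Ici, mem_Iio, Pi.zero_apply] at *
      linarith
  rw [setLIntegral_congr_fun measurableSet_Ici h1, ← ofReal_integral_eq_lintegral_ofReal]
  · rw [integral_add (hi.integrableOn.const_mul _) (integrable_const _), integral_const_mul,
      setIntegral_Ici_id_gaussianReal hv]
    -- The two tail contributions are `v φ(s)` weighted by the masses of `Iio s` and `Ici s`, which
    -- add up to one.
    have := probReal_compl_eq_one_sub (μ := gaussianReal 0 v) (measurableSet_Iio (a := s))
    rw [compl_Iio] at this
    simp only [integral_const, MeasurableSet.univ, measureReal_restrict_apply, univ_inter,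
      smul_eq_mul, this]
    ring_nf
  · exact (hi.integrableOn.const_mul _).add (integrable_const _)
  · have hi2 : ∀ x ∈ Ici s, 0 ≤ (gaussianReal 0 v).real (Iio s) * x + v * gaussianPDFReal 0 v s := by
      intro x hx
      have : 0 ≤ ∫ y in Iio s, (x - y) ∂(gaussianReal 0 v) :=
        setIntegral_nonneg measurableSet_Iio fun y hy => by
          simp only [mem_Ici, mem_Iio] at *; linarith
      rw [integral_sub (integrable_const _) hi.integrableOn,
        setIntegral_Iio_id_gaussianReal hv] at this
      simpa using this
    exact (ae_restrict_iff' measurableSet_Ici).2 (.of_forall hi2)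

/-- The fundamental theorem of calculus followed by Cauchy–Schwarz on `[y, x]`. The bound is stated
as a lower integral so that Tonelli applies later without integrability conditions. -/
lemma norm_sub_sq_le_lintegral {E : Type*} [NormedAddCommGroup E] [NormedSpace ℝ E]
    [CompleteSpace E] {f f' : ℝ → E} (hf : ∀ x, HasDerivAt f (f' x) x)
    (hf' : Continuous f') {x y : ℝ} (hxy : y ≤ x) :
    ‖f x - f y‖ₑ ^ 2 ≤ ∫⁻ s in Ioc y x, ENNReal.ofReal (x - y) * ‖f' s‖ₑ ^ 2 := by
  rcases hxy.eq_or_lt with rfl | hxy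
  · simp
  have hI : ∀ g : ℝ → ℝ, Continuous g → IntervalIntegrable g volume y x := fun g hg =>
    hg.intervalIntegrable _ _
  set J := ∫ s in y..x, ‖f' s‖ with hJ
  have h1 : ‖f x - f y‖ ≤ J := by
    rw [← intervalIntegral.integral_eq_sub_of_hasDerivAt (fun s _ => hf s)
      (hf'.intervalIntegrable _ _)]
    exact intervalIntegral.norm_integral_le_integral_norm hxy.le
  have h2 : J ^ 2 ≤ (x - y) * ∫ s in y..x, ‖f' s‖ ^ 2 := by
    -- Cauchy–Schwarz in the form that the variance of `‖f'‖` about its mean `J / (x - y)` is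
    -- nonnegative.
    have h0 : 0 ≤ ∫ s in y..x, (‖f' s‖ - J / (x - y)) ^ 2 :=
      intervalIntegral.integral_nonneg hxy.le fun s _ => sq_nonneg _
    have e : ∀ s, (‖f' s‖ - J / (x - y)) ^ 2 =
        ‖f' s‖ ^ 2 - 2 * (J / (x - y)) * ‖f' s‖ + (J / (x - y)) ^ 2 := fun s => by ring
    simp_rw [e] at h0
    rw [intervalIntegral.integral_add (hI _ (by fun_prop)) (hI _ (by fun_prop)),
      intervalIntegral.integral_sub (hI _ (by fun_prop)) (hI _ (by fun_prop)),
      intervalIntegral.integral_const_mul, ← hJ, intervalIntegral.integral_const,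
      smul_eq_mul] at h0
    have hpos : 0 < x - y := sub_pos.2 hxy
    have : (x - y) * (J / (x - y)) = J := by field_simp
    nlinarith [mul_nonneg hpos.le h0]
  have h3 : ‖f x - f y‖ ^ 2 ≤ (x - y) * ∫ s in Ioc y x, ‖f' s‖ ^ 2 := by
    rw [← intervalIntegral.integral_of_le hxy.le]
    exact (pow_le_pow_left₀ (norm_nonneg _) h1 2).trans h2
  have h4 := ENNReal.ofReal_le_ofReal h3
  rw [ENNReal.ofReal_pow (norm_nonneg _), ofReal_norm, ENNReal.ofReal_mul (sub_pos.2 hxy).le,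
    ofReal_integral_eq_lintegral_ofReal] at h4
  · refine h4.trans (le_of_eq ?_)
    rw [← lintegral_const_mul']
    · refine lintegral_congr fun s => ?_
      rw [ENNReal.ofReal_pow (norm_nonneg _), ofReal_norm]
    · exact ENNReal.ofReal_ne_top
  · have : Continuous fun s => ‖f' s‖ ^ 2 := by fun_prop
    exact (this.integrableOn_Icc (a := y) (b := x)).mono_set Ioc_subset_Icc_self
  · exact .of_forall fun s => by positivity

/-- The Poincaré inequality for the one-dimensional Gaussian measure. -/
lemma lintegral_enorm_sub_sq_gaussianReal_le {E : Type*} [NormedAddCommGroup E] [NormedSpace ℝ E]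
    [CompleteSpace E] {v : ℝ≥0} (hv : v ≠ 0) {f f' : ℝ → E}
    (hf : ∀ x, HasDerivAt f (f' x) x) (hf' : Continuous f') :
    ∫⁻ x, ∫⁻ y, ‖f x - f y‖ₑ ^ 2 ∂(gaussianReal 0 v) ∂(gaussianReal 0 v) ≤
      2 * v * ∫⁻ x, ‖f' x‖ₑ ^ 2 ∂(gaussianReal 0 v) := by
  set γ := gaussianReal 0 v with hγ
  set B : ℝ → ℝ → ℝ → ℝ≥0∞ := fun x y s =>
    (if y < s ∧ s ≤ x then ENNReal.ofReal (x - y) * ‖f' s‖ₑ ^ 2 else 0) with hB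
  have hw : Measurable fun s => ‖f' s‖ₑ ^ 2 := by
    have : Continuous fun s => ‖f' s‖ₑ ^ 2 := by fun_prop
    exact this.measurable
  have hBm : Measurable fun q : ℝ × ℝ × ℝ => B q.1 q.2.1 q.2.2 := by
    refine Measurable.ite ?_ ?_ measurable_const
    · exact (measurableSet_lt (f := fun q : ℝ × ℝ × ℝ => q.2.1) (g := fun q => q.2.2)
        (by fun_prop) (by fun_prop)).inter
        (measurableSet_le (f := fun q : ℝ × ℝ × ℝ => q.2.2) (g := fun q => q.1)
        (by fun_prop) (by fun_prop))
    · exact (ENNReal.measurable_ofReal.comp (by fun_prop)).mul (hw.comp (by fun_prop))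
  set A : ℝ → ℝ → ℝ≥0∞ := fun x y => ∫⁻ s, B x y s with hA
  have hAm : Measurable (Function.uncurry A) := by
    have : Measurable fun q : (ℝ × ℝ) × ℝ => B q.1.1 q.1.2 q.2 :=
      hBm.comp (f := fun q : (ℝ × ℝ) × ℝ => (q.1.1, q.1.2, q.2)) (by fun_prop)
    exact this.lintegral_prod_right
  have hAeq : ∀ x y, A x y = ∫⁻ s in Ioc y x, ENNReal.ofReal (x - y) * ‖f' s‖ₑ ^ 2 := by
    intro x y
    rw [hA, ← lintegral_indicator measurableSet_Ioc]
    refine lintegral_congr fun s => ?_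
    simp [hB, indicator_apply]
  have hle : ∀ x y, ‖f x - f y‖ₑ ^ 2 ≤ A x y + A y x := by
    intro x y
    rcases le_total y x with h | h
    · exact ((norm_sub_sq_le_lintegral hf hf' h).trans_eq (hAeq x y).symm).trans le_self_add
    · rw [← enorm_neg, neg_sub]
      exact ((norm_sub_sq_le_lintegral hf hf' h).trans_eq (hAeq y x).symm).trans le_add_self
  have hswap : ∫⁻ x, ∫⁻ y, A y x ∂γ ∂γ = ∫⁻ x, ∫⁻ y, A x y ∂γ ∂γ :=
    lintegral_lintegral_swap (f := fun x y => A y x) (hAm.comp measurable_swap).aemeasurable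
  -- By Tonelli the Lebesgue variable `s` is integrated last. For fixed `s`, the integral of `x - y`
  -- over `y < s ≤ x` is `v` times the density at `s`, so `ds` becomes the Gaussian measure again.
  -- The reversed order of `x` and `y` gives the same amount, hence the factor 2.
  have hmain : ∫⁻ x, ∫⁻ y, A x y ∂γ ∂γ = v * ∫⁻ x, ‖f' x‖ₑ ^ 2 ∂γ := by
    have s1 : ∀ x, ∫⁻ y, A x y ∂γ = ∫⁻ s, ∫⁻ y, B x y s ∂γ := fun x =>
      lintegral_lintegral_swap (f := fun y s => B x y s)
        (hBm.comp (f := fun q : ℝ × ℝ => (x, q.1, q.2)) (by fun_prop)).aemeasurable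
    simp_rw [s1]
    rw [lintegral_lintegral_swap (f := fun x s => ∫⁻ y, B x y s ∂γ)]
    · have s2 : ∀ s, ∫⁻ x, ∫⁻ y, B x y s ∂γ ∂γ =
          gaussianPDF 0 v s * (v * ‖f' s‖ₑ ^ 2) := by
        intro s
        have s3 : ∀ x y, B x y s = (Ici s).indicator (fun x => (Iio s).indicator
            (fun y => ENNReal.ofReal (x - y) * ‖f' s‖ₑ ^ 2) y) x := by
          intro x y
          by_cases h1 : s ≤ x <;> by_cases h2 : y < s <;> simp [hB, h1, h2]
        have s4 : ∀ x, ∫⁻ y, B x y s ∂γ = (Ici s).indicator (fun x => ∫⁻ y in Iio s,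
            ENNReal.ofReal (x - y) * ‖f' s‖ₑ ^ 2 ∂γ) x := by
          intro x
          simp_rw [s3]
          by_cases h1 : s ≤ x
          · simp [h1, lintegral_indicator]
          · simp [h1]
        simp_rw [s4]
        rw [lintegral_indicator measurableSet_Ici]
        have s5 : ∀ x, ∫⁻ y in Iio s, ENNReal.ofReal (x - y) * ‖f' s‖ₑ ^ 2 ∂γ =
            (∫⁻ y in Iio s, ENNReal.ofReal (x - y) ∂γ) * ‖f' s‖ₑ ^ 2 := fun x =>
          lintegral_mul_const' _ _ (by simp)
        simp_rw [s5]
        rw [lintegral_mul_const' _ _ (by simp),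
          lintegral_Ici_lintegral_Iio_sub_gaussianReal hv, ENNReal.ofReal_mul (p := (v : ℝ)) v.2,
          gaussianPDF_def]
        simp only [ENNReal.ofReal_coe_nnreal]
        ring
      simp_rw [s2]
      rw [hγ, gaussianReal_of_var_ne_zero _ hv,
        ← lintegral_const_mul _ hw,
        lintegral_withDensity_eq_lintegral_mul _ (measurable_gaussianPDF 0 v)
          (hw.const_mul _)]
      rfl
    · have : Measurable fun q : (ℝ × ℝ) × ℝ => B q.1.1 q.2 q.1.2 :=
        hBm.comp (f := fun q : (ℝ × ℝ) × ℝ => (q.1.1, q.2, q.1.2)) (by fun_prop)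
      exact (this.lintegral_prod_right (ν := γ)).aemeasurable
  calc _ ≤ ∫⁻ x, ∫⁻ y, (A x y + A y x) ∂γ ∂γ :=
        lintegral_mono fun x => lintegral_mono fun y => hle x y
    _ = ∫⁻ x, ((∫⁻ y, A x y ∂γ) + ∫⁻ y, A y x ∂γ) ∂γ := by
        refine lintegral_congr fun x => ?_
        exact lintegral_add_left (hAm.comp measurable_prodMk_left) _
    _ = _ := by
        rw [lintegral_add_left hAm.lintegral_prod_right, hswap, hmain]
        ring

end GaussianReal

/-! ### Product Gaussian measures: integration by parts and Poincaré inequality -/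

section GaussianPi

variable {ι : Type*} [Fintype ι]

/-- The law of a family of independent centred Gaussian variables of variance `v`. -/
noncomputable abbrev gaussianPi (ι : Type*) [Fintype ι] (v : ℝ≥0) : Measure (ι → ℝ) :=
  Measure.pi fun _ : ι => gaussianReal 0 v

lemma integrable_smul_gaussianPi {E : Type*} [NormedAddCommGroup E] [NormedSpace ℝ E]
    (v : ℝ≥0) (t : ι) {f : (ι → ℝ) → E} (hfc : Continuous f) {C : ℝ} (hC : ∀ x, ‖f x‖ ≤ C) :
    Integrable (fun y => y t • f y) (gaussianPi ι v) := by
  have h : Integrable (fun x : ℝ => x) (gaussianReal 0 v) :=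
    (memLp_id_gaussianReal 1).integrable le_rfl
  have h' : Integrable (fun y : ι → ℝ => y t) (gaussianPi ι v) :=
    (measurePreserving_eval (fun _ : ι => gaussianReal 0 v) t).integrable_comp_of_integrable h
  exact h'.smul_bdd C hfc.aestronglyMeasurable (.of_forall hC)

variable [DecidableEq ι]

/-- Gaussian integration by parts in one of the coordinates. -/
lemma integral_smul_gaussianPi {E : Type*} [NormedAddCommGroup E] [NormedSpace ℝ E]
    [CompleteSpace E] {v : ℝ≥0} (hv : v ≠ 0) (t : ι) {f f' : (ι → ℝ) → E}
    (hf : ∀ y s, HasDerivAt (fun s => f (Function.update y t s)) (f' (Function.update y t s)) s)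
    (hfc : Continuous f) (hf' : Continuous f') {C C' : ℝ} (hC : ∀ x, ‖f x‖ ≤ C)
    (hC' : ∀ x, ‖f' x‖ ≤ C') :
    ∫ y, y t • f y ∂(gaussianPi ι v) = (v : ℝ) • ∫ y, f' y ∂(gaussianPi ι v) := by
  have hmp := measurePreserving_update (fun _ : ι => gaussianReal 0 v) t
  have hF : Integrable (fun y => y t • f y) (gaussianPi ι v) :=
    integrable_smul_gaussianPi v t hfc hC
  have hF' : Integrable f' (gaussianPi ι v) :=
    .of_bound hf'.aestronglyMeasurable C' (.of_forall hC')
  -- Resampling coordinate `t` preserves the law, so by Fubini the one-dimensional identity can be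
  -- used with the other coordinates frozen.
  have key : ∀ g : (ι → ℝ) → E, Integrable g (gaussianPi ι v) → ∫ y, g y ∂(gaussianPi ι v) =
      ∫ y, ∫ s, g (Function.update y t s) ∂(gaussianReal 0 v) ∂(gaussianPi ι v) := by
    intro g hg
    have hmp : MeasurePreserving _ _ (gaussianPi ι v) := hmp
    conv_lhs => rw [← hmp.map_eq]
    rw [integral_map hmp.measurable.aemeasurable (by rw [hmp.map_eq]; exact hg.1)]
    exact integral_prod _ (hmp.integrable_comp_of_integrable hg)
  rw [key _ hF, key _ hF', ← integral_smul]
  congr 1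
  ext y
  simp only [Function.update_self]
  have hu : Continuous fun s : ℝ => Function.update y t s := continuous_const.update t continuous_id
  exact integral_smul_gaussianReal hv (hf y) (hf'.comp hu) (fun s => hC _) (fun s => hC' _)

lemma ofReal_integral_norm_sq {β E : Type*} [MeasurableSpace β] [NormedAddCommGroup E]
    {μ : Measure β} [IsFiniteMeasure μ] {g : β → E} (hg : AEStronglyMeasurable g μ) {C : ℝ}
    (hC : ∀ x, ‖g x‖ ≤ C) :
    ENNReal.ofReal (∫ x, ‖g x‖ ^ 2 ∂μ) = ∫⁻ x, ‖g x‖ₑ ^ 2 ∂μ := by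
  rw [ofReal_integral_eq_lintegral_ofReal]
  · refine lintegral_congr fun x => ?_
    rw [ENNReal.ofReal_pow (norm_nonneg _), ofReal_norm]
  · refine .of_bound (hg.norm.pow 2) (C ^ 2) (.of_forall fun x => ?_)
    rw [Real.norm_of_nonneg (by positivity)]
    gcongr
    exact hC x
  · exact .of_forall fun x => by positivity

/-- The Gaussian Poincaré inequality. -/
lemma integral_norm_sub_integral_sq_gaussianPi_le {E : Type*} [NormedAddCommGroup E]
    [InnerProductSpace ℝ E] [CompleteSpace E] {v : ℝ≥0} (hv : v ≠ 0)
    {f : (ι → ℝ) → E} {f' : ι → (ι → ℝ) → E}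
    (hf : ∀ t y s, HasDerivAt (fun s => f (Function.update y t s))
      (f' t (Function.update y t s)) s)
    (hfc : Continuous f) (hf' : ∀ t, Continuous (f' t)) {C C' : ℝ} (hC : ∀ x, ‖f x‖ ≤ C)
    (hC' : ∀ t x, ‖f' t x‖ ≤ C') :
    ∫ y, ‖f y - ∫ x, f x ∂(gaussianPi ι v)‖ ^ 2 ∂(gaussianPi ι v) ≤
      v * ∑ t, ∫ y, ‖f' t y‖ ^ 2 ∂(gaussianPi ι v) := by
  have hfm : StronglyMeasurable f := hfc.stronglyMeasurable
  have h1 := integral_norm_sub_sq_le_sum (fun _ : ι => gaussianReal 0 v) hfm hC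
  rw [integral_norm_sub_integral_sq _ hfm hC] at h1
  have h2 : ∀ t : ι, ∫ z, ‖f z.1 - f (Function.update z.1 t (z.2 t))‖ ^ 2
      ∂((gaussianPi ι v).prod (gaussianPi ι v)) ≤
      2 * v * ∫ y, ‖f' t y‖ ^ 2 ∂(gaussianPi ι v) := by
    intro t
    have hmp := measurePreserving_update (fun _ : ι => gaussianReal 0 v) t
    have hev := measurePreserving_eval (fun _ : ι => gaussianReal 0 v) t
    have hup : Continuous fun z : (ι → ℝ) × ℝ => Function.update z.1 t z.2 :=
      continuous_fst.update t continuous_snd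
    have hG : Measurable fun z : (ι → ℝ) × ℝ => ‖f z.1 - f (Function.update z.1 t z.2)‖ₑ ^ 2 := by
      have : Continuous fun z : (ι → ℝ) × ℝ => ‖f z.1 - f (Function.update z.1 t z.2)‖ₑ ^ 2 := by
        fun_prop
      exact this.measurable
    have hG1 : Measurable fun y : ι → ℝ =>
        ∫⁻ s, ‖f y - f (Function.update y t s)‖ₑ ^ 2 ∂(gaussianReal 0 v) :=
      hG.lintegral_prod_right'
    have hG' : Measurable fun z : (ι → ℝ) × (ι → ℝ) =>
        ‖f z.1 - f (Function.update z.1 t (z.2 t))‖ₑ ^ 2 :=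
      hG.comp (f := fun z : (ι → ℝ) × (ι → ℝ) => (z.1, z.2 t)) (by fun_prop)
    have hw : Measurable fun y => ‖f' t y‖ₑ ^ 2 := by
      have := hf' t
      have : Continuous fun y => ‖f' t y‖ₑ ^ 2 := by fun_prop
      exact this.measurable
    have hcm : Continuous fun z : (ι → ℝ) × (ι → ℝ) =>
        f z.1 - f (Function.update z.1 t (z.2 t)) := by
      have : Continuous fun z : (ι → ℝ) × (ι → ℝ) => Function.update z.1 t (z.2 t) :=
        continuous_fst.update t ((continuous_apply t).comp continuous_snd)
      fun_prop
    have hI : 0 ≤ ∫ y, ‖f' t y‖ ^ 2 ∂(gaussianPi ι v) := integral_nonneg fun y => by positivity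
    rw [← ENNReal.ofReal_le_ofReal_iff (by positivity), ENNReal.ofReal_mul (by positivity),
      ENNReal.ofReal_mul (by positivity),
      ofReal_integral_norm_sq (C := C + C) hcm.aestronglyMeasurable
        (fun z => (norm_sub_le _ _).trans (add_le_add (hC _) (hC _))),
      ofReal_integral_norm_sq (hf' t).aestronglyMeasurable (hC' t)]
    rw [lintegral_prod _ hG'.aemeasurable]
    have e1 : ∀ x : ι → ℝ, ∫⁻ y, ‖f x - f (Function.update x t (y t))‖ₑ ^ 2 ∂(gaussianPi ι v) =
        ∫⁻ s, ‖f x - f (Function.update x t s)‖ₑ ^ 2 ∂(gaussianReal 0 v) := fun x =>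
      hev.lintegral_comp (f := fun s => ‖f x - f (Function.update x t s)‖ₑ ^ 2)
        (hG.comp measurable_prodMk_left)
    simp only [e1]
    have key : ∀ g : (ι → ℝ) → ENNReal, Measurable g → ∫⁻ y, g y ∂(gaussianPi ι v) =
        ∫⁻ y, ∫⁻ s, g (Function.update y t s) ∂(gaussianReal 0 v) ∂(gaussianPi ι v) :=
      fun g hg => by
        rw [← hmp.lintegral_comp hg]
        exact lintegral_prod _ (hg.comp hmp.measurable).aemeasurable
    have hw' : Measurable fun y => ∫⁻ s, ‖f' t (Function.update y t s)‖ₑ ^ 2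
        ∂(gaussianReal 0 v) := (hw.comp hmp.measurable).lintegral_prod_right'
    rw [key _ hG1, key _ hw, ← lintegral_const_mul _ hw']
    refine lintegral_mono fun y => ?_
    have hu : Continuous fun s : ℝ => Function.update y t s :=
      continuous_const.update t continuous_id
    have := lintegral_enorm_sub_sq_gaussianReal_le hv (hf t y) ((hf' t).comp hu)
    simpa using this
  -- Efron–Stein bounds twice the variance, and the factor 2 in `h2` cancels it.
  have h3 := h1.trans (Finset.sum_le_sum fun t _ => h2 t)
  rw [← Finset.mul_sum] at h3
  linarith

end GaussianPi

/-! ### Operator norm, Frobenius norm and resolvent bounds -/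

section OperatorNorm

variable {ι κ : Type*} [Fintype ι] [Fintype κ] [DecidableEq κ]

lemma sum_norm_mulVec_sq_le (A : Matrix ι κ ℂ) (x : κ → ℂ) :
    ∑ i, ‖(A *ᵥ x) i‖ ^ 2 ≤ ‖A‖ ^ 2 * ∑ j, ‖x j‖ ^ 2 := by
  have h := A.l2_opNorm_mulVec (WithLp.toLp 2 x)
  have h2 := pow_le_pow_left₀ (norm_nonneg _) h 2
  rw [mul_pow, EuclideanSpace.norm_sq_eq, EuclideanSpace.norm_sq_eq] at h2
  exact h2

lemma l2_opNorm_le_of_sum_le {A : Matrix ι κ ℂ} {c : ℝ} (hc : 0 ≤ c)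
    (h : ∀ x : κ → ℂ, ∑ i, ‖(A *ᵥ x) i‖ ^ 2 ≤ c ^ 2 * ∑ j, ‖x j‖ ^ 2) : ‖A‖ ≤ c := by
  rw [Matrix.l2_opNorm_def]
  refine ContinuousLinearMap.opNorm_le_bound _ hc fun x => ?_
  refine le_of_sq_le_sq ?_ (by positivity)
  rw [mul_pow, EuclideanSpace.norm_sq_eq, EuclideanSpace.norm_sq_eq]
  exact h x

/-- The squared Frobenius norm. -/
noncomputable def frobSq (A : Matrix ι κ ℂ) : ℝ := ∑ i, ∑ j, ‖A i j‖ ^ 2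

omit [DecidableEq κ] in
lemma frobSq_nonneg (A : Matrix ι κ ℂ) : 0 ≤ frobSq A :=
  Finset.sum_nonneg fun _ _ => Finset.sum_nonneg fun _ _ => by positivity

omit [DecidableEq κ] in
lemma frobSq_conjTranspose (A : Matrix ι κ ℂ) : frobSq Aᴴ = frobSq A := by
  rw [frobSq, Finset.sum_comm]
  simp [frobSq, Matrix.conjTranspose_apply]

lemma frobSq_mul_le_left {μ : Type*} [Fintype μ] (A : Matrix ι κ ℂ) (B : Matrix κ μ ℂ) :
    frobSq (A * B) ≤ ‖A‖ ^ 2 * frobSq B := by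
  rw [frobSq, frobSq, Finset.sum_comm, Finset.sum_comm (γ := κ), Finset.mul_sum]
  exact Finset.sum_le_sum fun j _ => sum_norm_mulVec_sq_le A fun k => B k j

lemma frobSq_mul_le_right {μ : Type*} [Fintype μ] (B : Matrix μ ι ℂ) [DecidableEq ι]
    (A : Matrix ι κ ℂ) :
    frobSq (B * A) ≤ ‖A‖ ^ 2 * frobSq B := by
  rw [← frobSq_conjTranspose, Matrix.conjTranspose_mul, ← frobSq_conjTranspose B,
    ← Matrix.l2_opNorm_conjTranspose A]
  exact frobSq_mul_le_left _ _

/-- The operator norm is at most the Frobenius norm. -/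
lemma l2_opNorm_sq_le_frobSq (A : Matrix ι κ ℂ) : ‖A‖ ^ 2 ≤ frobSq A := by
  have h0 := frobSq_nonneg A
  have : ‖A‖ ≤ √(frobSq A) := by
    refine l2_opNorm_le_of_sum_le (Real.sqrt_nonneg _) fun x => ?_
    rw [Real.sq_sqrt h0, frobSq, Finset.sum_mul]
    refine Finset.sum_le_sum fun i _ => ?_
    calc ‖(A *ᵥ x) i‖ ^ 2 ≤ (∑ j, ‖A i j‖ * ‖x j‖) ^ 2 := by
          gcongr
          refine (norm_sum_le _ _).trans (Finset.sum_le_sum fun j _ => (norm_mul _ _).le)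
      _ ≤ _ := Finset.sum_mul_sq_le_sq_mul_sq _ _ _
  calc ‖A‖ ^ 2 ≤ √(frobSq A) ^ 2 := by gcongr
    _ = _ := Real.sq_sqrt h0

lemma norm_entry_le_l2_opNorm (A : Matrix ι κ ℂ) (i : ι) (j : κ) : ‖A i j‖ ≤ ‖A‖ := by
  refine le_of_sq_le_sq ?_ (norm_nonneg _)
  have h := sum_norm_mulVec_sq_le A (Pi.single j 1)
  have h1 : ∑ k, ‖(Pi.single j (1 : ℂ) : κ → ℂ) k‖ ^ 2 = 1 := by
    rw [Finset.sum_eq_single j] <;> simp +contextual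
  rw [h1, mul_one] at h
  refine le_trans ?_ h
  have := Finset.single_le_sum (f := fun i => ‖(A *ᵥ Pi.single j 1) i‖ ^ 2)
    (fun i _ => by positivity) (Finset.mem_univ i)
  simpa using this

omit [DecidableEq κ] in
lemma star_dotProduct_self_eq (x : κ → ℂ) : star x ⬝ᵥ x = ((∑ j, ‖x j‖ ^ 2 : ℝ) : ℂ) := by
  simp only [dotProduct, Pi.star_apply, RCLike.star_def, Complex.conj_mul']
  push_cast
  rfl

/-- A positive definite matrix `B` satisfies `1 ≤ ‖B⁻¹‖ B`. -/
lemma posSemidef_norm_inv_smul_sub_one {B : Matrix κ κ ℂ} (hB : B.PosDef) :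
    (((‖B⁻¹‖ : ℝ) : ℂ) • B - 1).PosSemidef := by
  have hD := hB.inv.posSemidef
  obtain ⟨F, hF⟩ : ∃ F : Matrix κ κ ℂ, B⁻¹ = Fᴴ * F := by
    open scoped MatrixOrder in
    exact CStarAlgebra.nonneg_iff_eq_star_mul_self.1 hD.nonneg
  have hn : ‖F‖ ^ 2 = ‖B⁻¹‖ := by rw [hF, Matrix.l2_opNorm_conjTranspose_mul_self, sq]
  have hdet : IsUnit B.det := (Matrix.isUnit_iff_isUnit_det B).1 hB.isUnit
  refine .of_dotProduct_mulVec_nonneg ?_ fun x => ?_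
  · refine Matrix.IsHermitian.sub ?_ Matrix.isHermitian_one
    rw [Matrix.IsHermitian, Matrix.conjTranspose_smul, hB.isHermitian.eq]
    simp
  set w := B *ᵥ x with hw
  -- With `B⁻¹ = Fᴴ F` and `w = B x`, the form `⟨x, B x⟩` is `‖F w‖ ^ 2`, while `‖x‖ ^ 2 = ‖Fᴴ F w‖
  -- ^ 2 ≤ ‖B⁻¹‖ ‖F w‖ ^ 2`.
  have hx : x = Fᴴ *ᵥ (F *ᵥ w) := by
    rw [Matrix.mulVec_mulVec, ← hF, hw, Matrix.mulVec_mulVec, Matrix.nonsing_inv_mul _ hdet,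
      Matrix.one_mulVec]
  have h1 : star x ⬝ᵥ w = star (F *ᵥ w) ⬝ᵥ (F *ᵥ w) := by
    conv_lhs => rw [hx]
    rw [Matrix.star_mulVec, Matrix.conjTranspose_conjTranspose, ← Matrix.dotProduct_mulVec]
  have h2 : ∑ j, ‖x j‖ ^ 2 ≤ ‖B⁻¹‖ * ∑ j, ‖(F *ᵥ w) j‖ ^ 2 := by
    rw [← hn, ← Matrix.l2_opNorm_conjTranspose F]
    conv_lhs => rw [hx]
    exact sum_norm_mulVec_sq_le _ _
  rw [Matrix.sub_mulVec, Matrix.smul_mulVec, Matrix.one_mulVec, dotProduct_sub, dotProduct_smul,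
    ← hw, h1, star_dotProduct_self_eq, star_dotProduct_self_eq, smul_eq_mul, ← Complex.ofReal_mul,
    ← Complex.ofReal_sub, Complex.zero_le_real]
  linarith

/-- The resolvent estimate: a matrix whose imaginary part `M` satisfies `1 ≤ c M` is invertible,
with inverse of norm at most `c`. -/
lemma isUnit_and_norm_inv_le {T M : Matrix κ κ ℂ} {c : ℝ} (hc : 0 ≤ c)
    (hM : T - Tᴴ = (2 * Complex.I) • M) (hcM : ((c : ℂ) • M - 1).PosSemidef) :
    IsUnit T ∧ ‖T⁻¹‖ ≤ c := by
  -- `T` is bounded below: `‖x‖ ^ 2 ≤ c Im ⟨x, T x⟩ ≤ c ‖x‖ ‖T x‖`. This gives injectivity, hence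
  -- invertibility, and the bound on the inverse.
  have key : ∀ x : κ → ℂ, ∑ j, ‖x j‖ ^ 2 ≤ c ^ 2 * ∑ j, ‖(T *ᵥ x) j‖ ^ 2 := by
    intro x
    set S := ∑ j, ‖x j‖ ^ 2 with hS
    set W := ∑ j, ‖(T *ᵥ x) j‖ ^ 2 with hW
    have hS0 : 0 ≤ S := Finset.sum_nonneg fun j _ => by positivity
    have hW0 : 0 ≤ W := Finset.sum_nonneg fun j _ => by positivity
    set q := star x ⬝ᵥ (T *ᵥ x) with hq
    have hq' : star x ⬝ᵥ (Tᴴ *ᵥ x) = star q := by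
      rw [hq, Matrix.star_dotProduct, Matrix.star_mulVec, Matrix.dotProduct_mulVec,
        Matrix.conjTranspose_conjTranspose]
    have h1 : q - star q = (2 * Complex.I) * (star x ⬝ᵥ (M *ᵥ x)) := by
      rw [← hq', hq, ← dotProduct_sub, ← Matrix.sub_mulVec, hM, Matrix.smul_mulVec,
        dotProduct_smul, smul_eq_mul]
    have h2 : star x ⬝ᵥ (M *ᵥ x) = (q.im : ℂ) := by
      have : q - star q = (2 * Complex.I) * (q.im : ℂ) := by
        apply Complex.ext <;> simp
        ring
      rw [this] at h1
      exact (mul_left_cancel₀ (by simp) h1).symm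
    have h3 := hcM.dotProduct_mulVec_nonneg x
    rw [Matrix.sub_mulVec, Matrix.smul_mulVec, Matrix.one_mulVec, dotProduct_sub,
      dotProduct_smul, h2, star_dotProduct_self_eq, ← hS, smul_eq_mul, ← Complex.ofReal_mul,
      ← Complex.ofReal_sub, Complex.zero_le_real] at h3
    have h4 : ‖q‖ ^ 2 ≤ S * W := by
      calc ‖q‖ ^ 2 ≤ (∑ j, ‖x j‖ * ‖(T *ᵥ x) j‖) ^ 2 := by
            gcongr
            refine (norm_sum_le _ _).trans (Finset.sum_le_sum fun j _ => ?_)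
            simp
        _ ≤ _ := Finset.sum_mul_sq_le_sq_mul_sq _ _ _
    have h5 : q.im ≤ ‖q‖ := (le_abs_self _).trans (Complex.abs_im_le_norm q)
    have h6 : S ≤ c * ‖q‖ := by nlinarith
    have h7 : S ^ 2 ≤ S * (c ^ 2 * W) := by
      calc S ^ 2 ≤ (c * ‖q‖) ^ 2 := by gcongr
        _ = c ^ 2 * ‖q‖ ^ 2 := by ring
        _ ≤ c ^ 2 * (S * W) := by gcongr
        _ = _ := by ring
    rcases hS0.eq_or_lt with h0 | h0
    · rw [← h0]; positivity
    · rw [sq] at h7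
      exact le_of_mul_le_mul_left h7 h0
  have hu : IsUnit T := by
    rw [← Matrix.mulVec_injective_iff_isUnit]
    intro x y hxy
    have h := key (x - y)
    rw [Matrix.mulVec_sub, sub_eq_zero.2 hxy] at h
    simp only [Pi.sub_apply, Pi.zero_apply, norm_zero, ne_eq, OfNat.ofNat_ne_zero,
      not_false_eq_true, zero_pow, Finset.sum_const_zero, mul_zero] at h
    ext j
    have := (Finset.sum_eq_zero_iff_of_nonneg (fun j _ => by positivity)).1
      (le_antisymm h (Finset.sum_nonneg fun j _ => by positivity)) j (Finset.mem_univ j)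
    simpa [sub_eq_zero] using this
  refine ⟨hu, l2_opNorm_le_of_sum_le hc fun x => ?_⟩
  have h := key (T⁻¹ *ᵥ x)
  rwa [Matrix.mulVec_mulVec, Matrix.mul_nonsing_inv _ ((Matrix.isUnit_iff_isUnit_det T).1 hu),
    Matrix.one_mulVec] at h

/-- The completely positive map `K ↦ ∑ i, a i * K * a i` is bounded by `‖∑ i, a i ^ 2‖`. -/
lemma norm_sum_mul_mul_le {r : Type*} [Fintype r] {a : r → Matrix κ κ ℂ}
    (ha : ∀ i, (a i).IsHermitian) (K : Matrix κ κ ℂ) :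
    ‖∑ i, a i * K * a i‖ ≤ ‖∑ i, a i ^ 2‖ * ‖K‖ := by
  set N := ‖∑ i, a i ^ 2‖ with hN
  have hN0 : 0 ≤ N := norm_nonneg _
  have hquad : ∀ x : κ → ℂ, ∑ i, ∑ j, ‖(a i *ᵥ x) j‖ ^ 2 ≤ N * ∑ j, ‖x j‖ ^ 2 := by
    intro x
    set S := ∑ j, ‖x j‖ ^ 2 with hS
    have hS0 : 0 ≤ S := Finset.sum_nonneg fun j _ => by positivity
    have e : ((∑ i, ∑ j, ‖(a i *ᵥ x) j‖ ^ 2 : ℝ) : ℂ) = star x ⬝ᵥ ((∑ i, a i ^ 2) *ᵥ x) := by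
      rw [Matrix.sum_mulVec, dotProduct_sum, Complex.ofReal_sum]
      refine Finset.sum_congr rfl fun i _ => ?_
      rw [← star_dotProduct_self_eq, Matrix.star_mulVec, (ha i).eq, ← Matrix.dotProduct_mulVec,
        Matrix.mulVec_mulVec, sq]
    have e2 : (∑ i, ∑ j, ‖(a i *ᵥ x) j‖ ^ 2) = ‖star x ⬝ᵥ ((∑ i, a i ^ 2) *ᵥ x)‖ := by
      rw [← e, Complex.norm_real, Real.norm_of_nonneg]
      exact Finset.sum_nonneg fun i _ => Finset.sum_nonneg fun j _ => by positivity
    rw [e2]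
    refine le_of_sq_le_sq ?_ (by positivity)
    calc ‖star x ⬝ᵥ ((∑ i, a i ^ 2) *ᵥ x)‖ ^ 2
        ≤ (∑ j, ‖x j‖ * ‖((∑ i, a i ^ 2) *ᵥ x) j‖) ^ 2 := by
          gcongr
          refine (norm_sum_le _ _).trans (Finset.sum_le_sum fun j _ => ?_)
          simp
      _ ≤ S * ∑ j, ‖((∑ i, a i ^ 2) *ᵥ x) j‖ ^ 2 := Finset.sum_mul_sq_le_sq_mul_sq _ _ _
      _ ≤ S * (N ^ 2 * S) := by gcongr; exact sum_norm_mulVec_sq_le _ _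
      _ = (N * S) ^ 2 := by ring
  refine l2_opNorm_le_of_sum_le (by positivity) fun x => ?_
  set y := (∑ i, a i * K * a i) *ᵥ x with hy
  set S := ∑ j, ‖x j‖ ^ 2 with hS
  set W := ∑ j, ‖y j‖ ^ 2 with hW
  have hS0 : 0 ≤ S := Finset.sum_nonneg fun j _ => by positivity
  have hW0 : 0 ≤ W := Finset.sum_nonneg fun j _ => by positivity
  -- Testing against the image vector `y` itself and moving the left factor `a i` across;
  -- Cauchy–Schwarz over all pairs `(i, j)` then leaves two sums controlled by `hquad`.
  have e : (W : ℂ) = ∑ i, star (a i *ᵥ y) ⬝ᵥ (K *ᵥ (a i *ᵥ x)) := by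
    have key : ∀ w : κ → ℂ, star w ⬝ᵥ ((∑ i, a i * K * a i) *ᵥ x) =
        ∑ i, star (a i *ᵥ w) ⬝ᵥ (K *ᵥ (a i *ᵥ x)) := fun w => by
      rw [Matrix.sum_mulVec, dotProduct_sum]
      refine Finset.sum_congr rfl fun i _ => ?_
      rw [Matrix.star_mulVec, (ha i).eq, ← Matrix.dotProduct_mulVec, Matrix.mulVec_mulVec,
        Matrix.mulVec_mulVec, mul_assoc]
    rw [hW, ← star_dotProduct_self_eq]
    exact key y
  have h1 : W ≤ ∑ p : r × κ, ‖(a p.1 *ᵥ y) p.2‖ * ‖(K *ᵥ (a p.1 *ᵥ x)) p.2‖ := by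
    have : W = ‖(W : ℂ)‖ := by rw [Complex.norm_real, Real.norm_of_nonneg hW0]
    rw [this, e, Fintype.sum_prod_type]
    refine (norm_sum_le _ _).trans (Finset.sum_le_sum fun i _ => ?_)
    refine (norm_sum_le _ _).trans (Finset.sum_le_sum fun j _ => ?_)
    simp
  have h2 : W ^ 2 ≤ (N * W) * (‖K‖ ^ 2 * (N * S)) := by
    have h3 : ∑ p : r × κ, ‖(a p.1 *ᵥ y) p.2‖ ^ 2 ≤ N * W := by
      rw [Fintype.sum_prod_type]
      exact hquad y
    have h4 : ∑ p : r × κ, ‖(K *ᵥ (a p.1 *ᵥ x)) p.2‖ ^ 2 ≤ ‖K‖ ^ 2 * (N * S) := by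
      rw [Fintype.sum_prod_type]
      calc _ ≤ ∑ i, ‖K‖ ^ 2 * ∑ j, ‖(a i *ᵥ x) j‖ ^ 2 :=
            Finset.sum_le_sum fun i _ => sum_norm_mulVec_sq_le K _
        _ = ‖K‖ ^ 2 * ∑ i, ∑ j, ‖(a i *ᵥ x) j‖ ^ 2 := by rw [Finset.mul_sum]
        _ ≤ _ := mul_le_mul_of_nonneg_left (hquad x) (by positivity)
    calc W ^ 2 ≤ _ := pow_le_pow_left₀ hW0 h1 2
      _ ≤ _ := Finset.sum_mul_sq_le_sq_mul_sq _ _ _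
      _ ≤ _ := mul_le_mul h3 h4 (Finset.sum_nonneg fun p _ => sq_nonneg _) (by positivity)
  rcases hW0.eq_or_lt with h0 | h0
  · rw [← h0]; positivity
  · refine le_of_mul_le_mul_left (a := W) ?_ h0
    calc W * W = W ^ 2 := (sq W).symm
      _ ≤ _ := h2
      _ = _ := by ring

end OperatorNorm

/-! ### The orthonormal basis of self-adjoint matrices and partial traces -/

section SelfAdjointBasis

variable {n : ℕ}

/-- The orthonormal basis of the self-adjoint matrices dual to the coordinates `saCoord`. -/
noncomputable def saBasis (p : Fin n × Fin n) : Matrix (Fin n) (Fin n) ℂ :=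
  Matrix.of fun a b =>
    if p.1 = p.2 then (if a = p.1 ∧ b = p.1 then 1 else 0)
    else if p.1 < p.2 then
      (if (a = p.1 ∧ b = p.2) ∨ (a = p.2 ∧ b = p.1) then (((√2)⁻¹ : ℝ) : ℂ) else 0)
    else if a = p.2 ∧ b = p.1 then (((√2)⁻¹ : ℝ) : ℂ) * Complex.I
    else if a = p.1 ∧ b = p.2 then -((((√2)⁻¹ : ℝ) : ℂ) * Complex.I)
    else 0

lemma saBasis_apply_eq_zero {p : Fin n × Fin n} {a b : Fin n} (h1 : p ≠ (a, b))
    (h2 : p ≠ (b, a)) : saBasis p a b = 0 := by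
  obtain ⟨k, l⟩ := p
  simp only [ne_eq, Prod.mk.injEq, not_and] at h1 h2
  simp only [saBasis, Matrix.of_apply]
  grind

lemma isHermitian_saBasis (p : Fin n × Fin n) : (saBasis p).IsHermitian := by
  obtain ⟨k, l⟩ := p
  ext a b
  simp only [saBasis, Matrix.conjTranspose_apply, Matrix.of_apply]
  split_ifs <;> first | grind | simp

lemma inv_sqrt_two_mul_self : (((√2)⁻¹ : ℝ) : ℂ) * (((√2)⁻¹ : ℝ) : ℂ) = 1 / 2 := by
  rw [← Complex.ofReal_mul, ← mul_inv, Real.mul_self_sqrt (by norm_num)]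
  norm_num

/-- The completeness relation of the basis `saBasis`. -/
lemma sum_saBasis_mul_saBasis (a b c d : Fin n) :
    ∑ p, saBasis p a b * saBasis p c d = if a = d ∧ b = c then 1 else 0 := by
  have hs := inv_sqrt_two_mul_self
  have hI := Complex.I_mul_I
  set s : ℂ := (((√2)⁻¹ : ℝ) : ℂ) with hsdef
  by_cases hab : a = b
  · subst hab
    rw [Finset.sum_eq_single (a, a)]
    · simp only [saBasis, Matrix.of_apply]
      grind
    · intro p _ hp
      rw [saBasis_apply_eq_zero hp hp, zero_mul]
    · simp
  -- Off the diagonal only the real and the imaginary basis element of the pair `{a, b}` contribute;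
  -- their halves cancel at `(c, d) = (a, b)` and add to one at `(b, a)`.
  · rw [Finset.sum_eq_add (a, b) (b, a)]
    · simp only [saBasis, Matrix.of_apply, ← hsdef]
      rcases lt_or_gt_of_ne hab with h | h
      · have h' := h.not_gt
        by_cases h1 : c = a ∧ d = b
        · obtain ⟨rfl, rfl⟩ := h1
          simp [hab, Ne.symm hab, h, h']
          linear_combination s * s * hI
        · by_cases h2 : c = b ∧ d = a
          · obtain ⟨rfl, rfl⟩ := h2
            simp [hab, Ne.symm hab, h, h']
            linear_combination 2 * hs - s * s * hI
          · grind
      · have h' := h.not_gt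
        by_cases h1 : c = a ∧ d = b
        · obtain ⟨rfl, rfl⟩ := h1
          simp [hab, Ne.symm hab, h, h']
          linear_combination s * s * hI
        · by_cases h2 : c = b ∧ d = a
          · obtain ⟨rfl, rfl⟩ := h2
            simp [hab, Ne.symm hab, h, h']
            linear_combination 2 * hs - s * s * hI
          · grind
    · simp [Prod.ext_iff]; grind
    · intro p _ hp
      rw [saBasis_apply_eq_zero hp.1 hp.2, zero_mul]
    · simp
    · simp

/-- A self-adjoint matrix is recovered from its coordinates. -/
lemma sum_saCoord_smul_saBasis {A : Matrix (Fin n) (Fin n) ℂ} (hA : A.IsHermitian) :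
    ∑ p, (saCoord A p : ℂ) • saBasis p = A := by
  have hs : ((√2 : ℝ) : ℂ) * (((√2)⁻¹ : ℝ) : ℂ) = 1 := by
    rw [← Complex.ofReal_mul, mul_inv_cancel₀ (by positivity)]; norm_num
  ext a b
  have hba : A b a = star (A a b) := (hA.apply b a).symm
  have hre : ∀ z : ℂ, (z.re : ℂ) + z.im * Complex.I = z := Complex.re_add_im
  simp only [Matrix.sum_apply, Matrix.smul_apply, smul_eq_mul]
  by_cases hab : a = b
  · subst hab
    rw [Finset.sum_eq_single (a, a)]
    · have := hA.coe_re_apply_self a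
      simpa [saBasis, saCoord] using this
    · intro p _ hp
      rw [saBasis_apply_eq_zero hp hp, mul_zero]
    · simp
  · rw [Finset.sum_eq_add (a, b) (b, a)]
    · rcases lt_or_gt_of_ne hab with h | h
      · have h' := h.not_gt
        simp only [saBasis, saCoord, Matrix.of_apply]
        simp only [hab, Ne.symm hab, h, h', if_true, if_false, and_self, true_or,
          Complex.ofReal_mul]
        linear_combination (((A a b).re : ℂ) + (A a b).im * Complex.I) * hs + hre (A a b)
      · have h' := h.not_gt
        simp only [saBasis, saCoord, Matrix.of_apply]
        simp only [hab, Ne.symm hab, h, h', if_true, if_false, and_self, or_true,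
          Complex.ofReal_mul, hba, RCLike.star_def, Complex.conj_re, Complex.conj_im,
          Complex.ofReal_neg]
        linear_combination (((A a b).re : ℂ) + (A a b).im * Complex.I) * hs + hre (A a b)
    · simp [Prod.ext_iff]; grind
    · intro p _ hp
      rw [saBasis_apply_eq_zero hp.1 hp.2, mul_zero]
    · simp
    · simp

/-- Parseval's identity for the basis `saBasis`. -/
lemma sum_norm_trace_saBasis_mul_sq (B : Matrix (Fin n) (Fin n) ℂ) :
    ∑ p, ‖(saBasis p * B).trace‖ ^ 2 = frobSq B := by
  have htr : ∀ p, (saBasis p * B).trace =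
      ∑ q : Fin n × Fin n, saBasis p q.1 q.2 * B q.2 q.1 := by
    intro p
    simp [Matrix.trace, Matrix.mul_apply, Fintype.sum_prod_type]
  have hstar : ∀ p, star (saBasis p * B).trace =
      ∑ q : Fin n × Fin n, saBasis p q.1 q.2 * star (B q.1 q.2) := by
    intro p
    rw [← Matrix.trace_conjTranspose, Matrix.conjTranspose_mul, (isHermitian_saBasis p).eq,
      Matrix.trace_mul_comm]
    simp [Matrix.trace, Matrix.mul_apply, Matrix.conjTranspose_apply, Fintype.sum_prod_type]
  have : ((∑ p, ‖(saBasis p * B).trace‖ ^ 2 : ℝ) : ℂ) = ((frobSq B : ℝ) : ℂ) := by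
    calc ((∑ p, ‖(saBasis p * B).trace‖ ^ 2 : ℝ) : ℂ)
        = ∑ p, (saBasis p * B).trace * star (saBasis p * B).trace := by
          push_cast
          refine Finset.sum_congr rfl fun p _ => ?_
          rw [← Complex.mul_conj', RCLike.star_def]
      _ = ∑ q : Fin n × Fin n, ∑ q' : Fin n × Fin n,
          (∑ p, saBasis p q.1 q.2 * saBasis p q'.1 q'.2) * (B q.2 q.1 * star (B q'.1 q'.2)) := by
          simp_rw [hstar, htr, Finset.sum_mul_sum]
          rw [Finset.sum_comm]
          refine Finset.sum_congr rfl fun q _ => ?_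
          rw [Finset.sum_comm]
          refine Finset.sum_congr rfl fun q' _ => ?_
          rw [Finset.sum_mul]
          exact Finset.sum_congr rfl fun p _ => by ring
      _ = ∑ q : Fin n × Fin n, B q.2 q.1 * star (B q.2 q.1) := by
          refine Finset.sum_congr rfl fun q _ => ?_
          rw [Finset.sum_eq_single q.swap]
          · simp [sum_saBasis_mul_saBasis]
          · intro q' _ hq'
            rw [sum_saBasis_mul_saBasis, if_neg, zero_mul]
            rintro ⟨h1, h2⟩
            exact hq' (Prod.ext h2.symm h1.symm)
          · simp
      _ = _ := by
          rw [Fintype.sum_prod_type_right, frobSq]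
          push_cast
          simp [Complex.mul_conj']
  exact_mod_cast this

variable {m : ℕ}

/-- The covariance map of the basis `saBasis`, amplified by `a`. -/
lemma sum_kronecker_saBasis_mul_mul (a : Matrix (Fin m) (Fin m) ℂ)
    (R : Matrix (Fin m × Fin n) (Fin m × Fin n) ℂ) (hn : n ≠ 0) :
    ∑ p, (a ⊗ₖ saBasis p) * R * (a ⊗ₖ saBasis p) =
      (n : ℂ) • ((a * idTensorTr R * a) ⊗ₖ (1 : Matrix (Fin n) (Fin n) ℂ)) := by
  have hn' : (n : ℂ) ≠ 0 := by exact_mod_cast hn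
  ext ⟨j, u⟩ ⟨k, w⟩
  have e : ∀ p, ((a ⊗ₖ saBasis p) * R * (a ⊗ₖ saBasis p)) (j, u) (k, w) =
      ∑ β, ∑ t, ∑ α, ∑ s, (saBasis p u s * saBasis p t w) *
        (a j α * R (α, s) (β, t) * a β k) := by
    intro p
    simp only [Matrix.mul_apply, Matrix.kronecker_apply, Fintype.sum_prod_type, Finset.sum_mul]
    refine Finset.sum_congr rfl fun β _ => Finset.sum_congr rfl fun t _ =>
      Finset.sum_congr rfl fun α _ => Finset.sum_congr rfl fun s _ => ?_
    ring
  have e2 : (∑ p, ∑ β, ∑ t, ∑ α, ∑ s, (saBasis p u s * saBasis p t w) *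
        (a j α * R (α, s) (β, t) * a β k)) =
      ∑ β, ∑ t, ∑ α, ∑ s, (if u = w ∧ s = t then 1 else 0) *
        (a j α * R (α, s) (β, t) * a β k) := by
    rw [Finset.sum_comm]
    refine Finset.sum_congr rfl fun β _ => ?_
    rw [Finset.sum_comm]
    refine Finset.sum_congr rfl fun t _ => ?_
    rw [Finset.sum_comm]
    refine Finset.sum_congr rfl fun α _ => ?_
    rw [Finset.sum_comm]
    refine Finset.sum_congr rfl fun s _ => ?_
    rw [← Finset.sum_mul, sum_saBasis_mul_saBasis]
  rw [Matrix.sum_apply]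
  simp_rw [e]
  rw [e2]
  simp only [Matrix.smul_apply, Matrix.kronecker_apply, Matrix.mul_apply, idTensorTr,
    Matrix.of_apply, Matrix.one_apply, smul_eq_mul]
  by_cases huw : u = w
  · simp only [huw, true_and, ite_mul, one_mul, zero_mul, Finset.sum_ite_eq', Finset.mem_univ,
      if_true, mul_one]
    rw [Finset.mul_sum]
    refine Finset.sum_congr rfl fun β _ => ?_
    rw [Finset.sum_comm, Finset.sum_mul, Finset.mul_sum]
    refine Finset.sum_congr rfl fun α _ => ?_
    rw [← Finset.sum_mul, ← Finset.mul_sum]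
    field_simp
  · simp [huw]

lemma idTensorTr_kronecker_one_mul (B : Matrix (Fin m) (Fin m) ℂ)
    (R : Matrix (Fin m × Fin n) (Fin m × Fin n) ℂ) :
    idTensorTr ((B ⊗ₖ (1 : Matrix (Fin n) (Fin n) ℂ)) * R) = B * idTensorTr R := by
  ext j k
  simp only [idTensorTr, Matrix.of_apply, Matrix.mul_apply, Matrix.kronecker_apply,
    Fintype.sum_prod_type, Matrix.one_apply, mul_ite, mul_one, mul_zero, ite_mul, zero_mul,
    Finset.sum_ite_eq, Finset.mem_univ, if_true]
  rw [Finset.sum_comm, Finset.mul_sum]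
  refine Finset.sum_congr rfl fun α _ => ?_
  rw [← Finset.mul_sum]
  ring

lemma frobSq_single_kronecker_one (j k : Fin m) :
    frobSq (Matrix.single j k (1 : ℂ) ⊗ₖ (1 : Matrix (Fin n) (Fin n) ℂ)) = n := by
  have h1 : ∀ x y : Fin m × Fin n,
      ‖(Matrix.single j k (1 : ℂ) ⊗ₖ (1 : Matrix (Fin n) (Fin n) ℂ)) x y‖ ^ 2 =
      (if j = x.1 then (if k = y.1 then (if x.2 = y.2 then 1 else 0) else 0) else 0) := by
    intro x y
    simp only [Matrix.kroneckerMap_apply, Matrix.single_apply, Matrix.one_apply]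
    split_ifs <;> simp_all
  simp only [frobSq, h1, Fintype.sum_prod_type]
  simp

/-- Expresses entries of the partial trace as full traces, so that cyclicity and the Bessel
inequality become available. -/
lemma idTensorTr_apply_eq_trace (T : Matrix (Fin m × Fin n) (Fin m × Fin n) ℂ) (j k : Fin m) :
    idTensorTr T j k =
      (1 / (n : ℂ)) * (T * (Matrix.single k j (1 : ℂ) ⊗ₖ (1 : Matrix (Fin n) (Fin n) ℂ))).trace := by
  simp only [idTensorTr, Matrix.of_apply, Matrix.trace, Matrix.diag_apply, Matrix.mul_apply,
    Matrix.kronecker_apply, Matrix.single_apply, Matrix.one_apply, Fintype.sum_prod_type]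
  congr 1
  simp [ite_and]

/-- A Bessel-type inequality for the matrices `a ⊗ saBasis p`. -/
lemma sum_norm_trace_kronecker_mul_sq_le (a : Matrix (Fin m) (Fin m) ℂ)
    (T : Matrix (Fin m × Fin n) (Fin m × Fin n) ℂ) :
    ∑ p : Fin n × Fin n, ‖((a ⊗ₖ saBasis p) * T).trace‖ ^ 2 ≤ frobSq a * frobSq T := by
  -- `B` contracts `T` with `a` over the first tensor factor. Parseval in the second factor gives
  -- `frobSq B`, and Cauchy–Schwarz in the first gives the factor `frobSq a`.
  set B : Matrix (Fin n) (Fin n) ℂ :=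
    Matrix.of fun s t => ∑ q : Fin m × Fin m, a q.1 q.2 * T (q.2, s) (q.1, t) with hB
  have h1 : ∀ p, ((a ⊗ₖ saBasis p) * T).trace = (saBasis p * B).trace := by
    intro p
    simp only [Matrix.trace, Matrix.diag_apply, Matrix.mul_apply, Matrix.kronecker_apply,
      Fintype.sum_prod_type, hB, Matrix.of_apply, Finset.mul_sum]
    rw [Finset.sum_comm]
    refine Finset.sum_congr rfl fun s _ => ?_
    refine Eq.trans (Finset.sum_congr rfl fun α _ => ?_) Finset.sum_comm
    refine Finset.sum_comm.trans ?_
    refine Finset.sum_congr rfl fun t _ => Finset.sum_congr rfl fun β _ => ?_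
    ring
  simp_rw [h1]
  rw [sum_norm_trace_saBasis_mul_sq]
  have h2 : ∀ s t, ‖B s t‖ ^ 2 ≤ frobSq a * ∑ q : Fin m × Fin m, ‖T (q.2, s) (q.1, t)‖ ^ 2 := by
    intro s t
    calc ‖B s t‖ ^ 2 ≤ (∑ q : Fin m × Fin m, ‖a q.1 q.2‖ * ‖T (q.2, s) (q.1, t)‖) ^ 2 := by
          gcongr
          exact (norm_sum_le _ _).trans (Finset.sum_le_sum fun q _ => (norm_mul _ _).le)
      _ ≤ _ := Finset.sum_mul_sq_le_sq_mul_sq _ _ _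
      _ = _ := by rw [frobSq, Fintype.sum_prod_type]
  calc frobSq B ≤ ∑ s, ∑ t, frobSq a * ∑ q : Fin m × Fin m, ‖T (q.2, s) (q.1, t)‖ ^ 2 :=
        Finset.sum_le_sum fun s _ => Finset.sum_le_sum fun t _ => h2 s t
    _ = frobSq a * frobSq T := by
        simp_rw [← Finset.mul_sum]
        congr 1
        simp only [frobSq, Fintype.sum_prod_type]
        refine Eq.trans (Finset.sum_congr rfl fun s _ => ?_) Finset.sum_comm
        refine Finset.sum_comm.trans (Eq.trans ?_ Finset.sum_comm)
        exact Finset.sum_congr rfl fun α _ => Finset.sum_comm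

end SelfAdjointBasis

/-! ### The resolvent as a smooth bounded function of the coordinates -/

section Resolvent

variable {m n r : ℕ}

lemma isHermitian_linPencil {a₀ : Matrix (Fin m) (Fin m) ℂ}
    {a : Fin r → Matrix (Fin m) (Fin m) ℂ} (ha₀ : a₀.IsHermitian) (ha : ∀ i, (a i).IsHermitian)
    {x : Fin r → Matrix (Fin n) (Fin n) ℂ} (hx : ∀ i, (x i).IsHermitian) :
    (linPencil a₀ a x).IsHermitian := by
  rw [Matrix.IsHermitian, linPencil, Matrix.conjTranspose_add, Matrix.conjTranspose_kronecker,
    ha₀.eq, Matrix.conjTranspose_one, Matrix.conjTranspose_sum]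
  simp_rw [Matrix.conjTranspose_kronecker, (ha _).eq, (hx _).eq]

/-- Invertibility of `z ⊗ 1 - S` for self-adjoint `S`, with the resolvent estimate. -/
lemma isUnit_and_norm_resolvent_le {z : Matrix (Fin m) (Fin m) ℂ} (hz : (imPart z).PosDef)
    {S : Matrix (Fin m × Fin n) (Fin m × Fin n) ℂ} (hS : S.IsHermitian) :
    IsUnit (z ⊗ₖ (1 : Matrix (Fin n) (Fin n) ℂ) - S) ∧
      ‖(z ⊗ₖ (1 : Matrix (Fin n) (Fin n) ℂ) - S)⁻¹‖ ≤ ‖(imPart z)⁻¹‖ := by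
  refine isUnit_and_norm_inv_le (M := imPart z ⊗ₖ (1 : Matrix (Fin n) (Fin n) ℂ))
    (norm_nonneg _) ?_ ?_
  · rw [Matrix.conjTranspose_sub, hS.eq, Matrix.conjTranspose_kronecker, Matrix.conjTranspose_one,
      sub_sub_sub_cancel_right, imPart, Matrix.smul_kronecker, smul_smul,
      mul_one_div_cancel (by simp), one_smul]
    ext ⟨j, u⟩ ⟨k, w⟩
    simp [sub_mul]
  · have h := (posSemidef_norm_inv_smul_sub_one hz).kronecker
      (Matrix.PosSemidef.one (n := Fin n) (R := ℂ))
    have e : ((‖(imPart z)⁻¹‖ : ℝ) : ℂ) • (imPart z ⊗ₖ (1 : Matrix (Fin n) (Fin n) ℂ)) - 1 =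
        (((‖(imPart z)⁻¹‖ : ℝ) : ℂ) • imPart z - 1) ⊗ₖ (1 : Matrix (Fin n) (Fin n) ℂ) := by
      ext ⟨j, u⟩ ⟨k, w⟩
      by_cases h : u = w <;> simp [Matrix.one_apply, h]
    rw [e]
    exact h

/-- The family of self-adjoint matrices with prescribed coordinates. -/
noncomputable def ofCoord (y : Fin r × (Fin n × Fin n) → ℝ) (i : Fin r) :
    Matrix (Fin n) (Fin n) ℂ :=
  ∑ p, (y (i, p) : ℂ) • saBasis p

lemma isHermitian_ofCoord (y : Fin r × (Fin n × Fin n) → ℝ) (i : Fin r) :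
    (ofCoord y i).IsHermitian := by
  rw [Matrix.IsHermitian, ofCoord, Matrix.conjTranspose_sum]
  simp_rw [Matrix.conjTranspose_smul, (isHermitian_saBasis _).eq]
  simp

variable (a₀ : Matrix (Fin m) (Fin m) ℂ) (a : Fin r → Matrix (Fin m) (Fin m) ℂ)
  (z : Matrix (Fin m) (Fin m) ℂ)

/-- The matrix `z ⊗ 1 - S` as a function of the coordinates. -/
noncomputable def shiftedPencil (y : Fin r × (Fin n × Fin n) → ℝ) :
    Matrix (Fin m × Fin n) (Fin m × Fin n) ℂ :=
  z ⊗ₖ (1 : Matrix (Fin n) (Fin n) ℂ) - linPencil a₀ a (ofCoord y)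

/-- The resolvent as a function of the coordinates. -/
noncomputable def resolventCoord (y : Fin r × (Fin n × Fin n) → ℝ) :
    Matrix (Fin m × Fin n) (Fin m × Fin n) ℂ :=
  (shiftedPencil a₀ a z y)⁻¹

lemma shiftedPencil_eq (y : Fin r × (Fin n × Fin n) → ℝ) :
    shiftedPencil a₀ a z y = (z - a₀) ⊗ₖ (1 : Matrix (Fin n) (Fin n) ℂ) -
      ∑ t : Fin r × (Fin n × Fin n), (y t : ℂ) • (a t.1 ⊗ₖ saBasis t.2) := by
  have h : ∀ i, a i ⊗ₖ ofCoord y i = ∑ p, (y (i, p) : ℂ) • (a i ⊗ₖ saBasis p) := by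
    intro i
    ext ⟨j, u⟩ ⟨k, w⟩
    simp only [Matrix.kronecker_apply, ofCoord, Matrix.sum_apply, Matrix.smul_apply, smul_eq_mul,
      Finset.mul_sum]
    exact Finset.sum_congr rfl fun p _ => by ring
  rw [shiftedPencil, linPencil, Fintype.sum_prod_type]
  simp_rw [h]
  rw [← sub_sub]
  congr 1
  ext ⟨j, u⟩ ⟨k, w⟩
  simp [sub_mul]

lemma shiftedPencil_update (y : Fin r × (Fin n × Fin n) → ℝ) (t : Fin r × (Fin n × Fin n))
    (s : ℝ) : shiftedPencil a₀ a z (Function.update y t s) =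
      shiftedPencil a₀ a z (Function.update y t 0) - (s : ℂ) • (a t.1 ⊗ₖ saBasis t.2) := by
  rw [shiftedPencil_eq, shiftedPencil_eq, sub_sub]
  congr 1
  rw [← Finset.add_sum_erase _ _ (Finset.mem_univ t), ← Finset.add_sum_erase _ _ (Finset.mem_univ t)]
  simp only [Function.update_self, Complex.ofReal_zero, zero_smul, zero_add]
  rw [add_comm]
  congr 1
  refine Finset.sum_congr rfl fun q hq => ?_
  rw [Function.update_of_ne (Finset.ne_of_mem_erase hq),
    Function.update_of_ne (Finset.ne_of_mem_erase hq)]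

lemma continuous_shiftedPencil :
    Continuous (shiftedPencil (n := n) a₀ a z) := by
  have : shiftedPencil (n := n) a₀ a z = fun y => (z - a₀) ⊗ₖ (1 : Matrix (Fin n) (Fin n) ℂ) -
      ∑ t : Fin r × (Fin n × Fin n), (y t : ℂ) • (a t.1 ⊗ₖ saBasis t.2) :=
    funext (shiftedPencil_eq a₀ a z)
  rw [this]
  fun_prop

variable {a₀ a z} (ha₀ : a₀.IsHermitian) (ha : ∀ i, (a i).IsHermitian) (hz : (imPart z).PosDef)

include ha₀ ha hz

lemma isUnit_shiftedPencil (y : Fin r × (Fin n × Fin n) → ℝ) :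
    IsUnit (shiftedPencil a₀ a z y) :=
  (isUnit_and_norm_resolvent_le hz (isHermitian_linPencil ha₀ ha (isHermitian_ofCoord y))).1

lemma norm_resolventCoord_le (y : Fin r × (Fin n × Fin n) → ℝ) :
    ‖resolventCoord a₀ a z y‖ ≤ ‖(imPart z)⁻¹‖ :=
  (isUnit_and_norm_resolvent_le hz (isHermitian_linPencil ha₀ ha (isHermitian_ofCoord y))).2

lemma continuous_resolventCoord : Continuous (resolventCoord (n := n) a₀ a z) := by
  rw [continuous_iff_continuousAt]
  intro y
  obtain ⟨u, hu⟩ := isUnit_shiftedPencil ha₀ ha hz y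
  have h := NormedRing.inverse_continuousAt u
  rw [hu] at h
  have : resolventCoord (n := n) a₀ a z = fun y => Ring.inverse (shiftedPencil a₀ a z y) :=
    funext fun y => Matrix.nonsing_inv_eq_ringInverse _
  rw [this]
  exact ContinuousAt.comp (f := shiftedPencil a₀ a z) h (continuous_shiftedPencil a₀ a z).continuousAt

/-- The derivative of the inverse is `-R A' R`, and the pencil is affine in each coordinate with
slope `-(a t.1 ⊗ₖ saBasis t.2)`; the two signs cancel. -/
lemma hasDerivAt_resolventCoord (t : Fin r × (Fin n × Fin n))
    (y : Fin r × (Fin n × Fin n) → ℝ) (s : ℝ) :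
    HasDerivAt (fun s => resolventCoord a₀ a z (Function.update y t s))
      (resolventCoord a₀ a z (Function.update y t s) * (a t.1 ⊗ₖ saBasis t.2) *
        resolventCoord a₀ a z (Function.update y t s)) s := by
  have h1 : HasDerivAt (fun s : ℝ => shiftedPencil a₀ a z (Function.update y t s))
      (-(a t.1 ⊗ₖ saBasis t.2)) s := by
    have e : (fun s : ℝ => shiftedPencil a₀ a z (Function.update y t s)) = fun s : ℝ =>
        shiftedPencil a₀ a z (Function.update y t 0) - (s : ℂ) • (a t.1 ⊗ₖ saBasis t.2) :=
      funext fun s => shiftedPencil_update a₀ a z y t s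
    rw [e]
    have := ((Complex.ofRealCLM.hasDerivAt (x := s)).smul_const
      (a t.1 ⊗ₖ saBasis t.2)).const_sub (shiftedPencil a₀ a z (Function.update y t 0))
    simpa using this
  obtain ⟨u, hu⟩ := isUnit_shiftedPencil ha₀ ha hz (Function.update y t s)
  have h2 := hasFDerivAt_ringInverse (𝕜 := ℝ) u
  rw [hu] at h2
  have h3 := h2.comp_hasDerivAt s h1
  have hinv : (↑u⁻¹ : Matrix (Fin m × Fin n) (Fin m × Fin n) ℂ) =
      resolventCoord a₀ a z (Function.update y t s) := by
    rw [resolventCoord, Matrix.nonsing_inv_eq_ringInverse, ← hu, Ring.inverse_unit]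
  have e : (fun s => resolventCoord a₀ a z (Function.update y t s)) =
      Ring.inverse ∘ fun s => shiftedPencil a₀ a z (Function.update y t s) :=
    funext fun s => Matrix.nonsing_inv_eq_ringInverse _
  rw [e]
  refine h3.congr_deriv ?_
  rw [hinv]
  simp

end Resolvent

/-! ### The master equation, the variance estimate and the master inequality -/

section MasterEquation

variable {m n r : ℕ}

/-- The partial trace `idTensorTr` as a continuous linear map. -/
noncomputable def idTensorTrL :
    Matrix (Fin m × Fin n) (Fin m × Fin n) ℂ →L[ℝ] Matrix (Fin m) (Fin m) ℂ :=
  LinearMap.toContinuousLinearMap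
    { toFun := idTensorTr
      map_add' := fun A B => by
        ext j k; simp [idTensorTr, Finset.sum_add_distrib, mul_add]
      map_smul' := fun c A => by
        ext j k
        simp only [idTensorTr, Matrix.of_apply, Matrix.smul_apply, RingHom.id_apply,
          ← Finset.smul_sum, mul_smul_comm] }

@[simp]
lemma idTensorTrL_apply (T : Matrix (Fin m × Fin n) (Fin m × Fin n) ℂ) :
    idTensorTrL T = idTensorTr T := rfl

/-- A matrix entry as a continuous linear map. -/
noncomputable def entryL (j k : Fin m) : Matrix (Fin m) (Fin m) ℂ →L[ℝ] ℂ :=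
  LinearMap.toContinuousLinearMap
    { toFun := fun A => A j k
      map_add' := fun _ _ => rfl
      map_smul' := fun _ _ => rfl }

lemma idTensorTr_one (hn : n ≠ 0) :
    idTensorTr (1 : Matrix (Fin m × Fin n) (Fin m × Fin n) ℂ) = 1 := by
  have hn' : (n : ℂ) ≠ 0 := by exact_mod_cast hn
  ext j k
  by_cases h : j = k <;> simp [idTensorTr, Matrix.one_apply, h, hn']

variable {a₀ : Matrix (Fin m) (Fin m) ℂ} {a : Fin r → Matrix (Fin m) (Fin m) ℂ}
  {z : Matrix (Fin m) (Fin m) ℂ} (ha₀ : a₀.IsHermitian) (ha : ∀ i, (a i).IsHermitian)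
  (hz : (imPart z).PosDef)

/-- The left side is the trace of `∑ i, a i ^ 2`, whose `m` diagonal entries are each at most the
operator norm. -/
lemma sum_frobSq_le {a : Fin r → Matrix (Fin m) (Fin m) ℂ} (ha : ∀ i, (a i).IsHermitian) :
    ∑ i, frobSq (a i) ≤ m * ‖∑ i, a i ^ 2‖ := by
  have e : ((∑ i, frobSq (a i) : ℝ) : ℂ) = ∑ l, (∑ i, a i ^ 2) l l := by
    simp only [Matrix.sum_apply]
    rw [Finset.sum_comm, Complex.ofReal_sum]
    refine Finset.sum_congr rfl fun i _ => ?_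
    simp only [frobSq, sq (a i), Matrix.mul_apply]
    push_cast
    refine Finset.sum_congr rfl fun l _ => Finset.sum_congr rfl fun q _ => ?_
    rw [← Complex.mul_conj', ← (ha i).apply q l, RCLike.star_def]
  have e2 : ∑ i, frobSq (a i) = ‖((∑ i, frobSq (a i) : ℝ) : ℂ)‖ := by
    rw [Complex.norm_real, Real.norm_of_nonneg (Finset.sum_nonneg fun i _ => frobSq_nonneg _)]
  rw [e2, e]
  calc _ ≤ ∑ l : Fin m, ‖(∑ i, a i ^ 2) l l‖ := norm_sum_le _ _
    _ ≤ ∑ _l : Fin m, ‖∑ i, a i ^ 2‖ :=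
        Finset.sum_le_sum fun l _ => norm_entry_le_l2_opNorm _ _ _
    _ = _ := by simp

include ha₀ ha hz

/-- All resolvents lie in one closed ball, compact in finite dimension. This supplies every
boundedness condition for integration by parts and Poincaré. -/
lemma exists_bound_comp_resolventCoord {E : Type*} [NormedAddCommGroup E]
    {F : Matrix (Fin m × Fin n) (Fin m × Fin n) ℂ → E} (hF : Continuous F) :
    ∃ C, ∀ y, ‖F (resolventCoord a₀ a z y)‖ ≤ C := by
  have : ProperSpace (Matrix (Fin m × Fin n) (Fin m × Fin n) ℂ) := FiniteDimensional.proper ℂ _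
  obtain ⟨C, hC⟩ := (isCompact_closedBall (0 : Matrix (Fin m × Fin n) (Fin m × Fin n) ℂ)
    ‖(imPart z)⁻¹‖).exists_bound_of_continuousOn hF.continuousOn
  exact ⟨C, fun y => hC _ (by simpa using norm_resolventCoord_le ha₀ ha hz y)⟩

lemma integrable_comp_resolventCoord {E : Type*} [NormedAddCommGroup E] (v : ℝ≥0)
    {F : Matrix (Fin m × Fin n) (Fin m × Fin n) ℂ → E} (hF : Continuous F) :
    Integrable (fun y => F (resolventCoord a₀ a z y))
      (gaussianPi (Fin r × (Fin n × Fin n)) v) := by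
  obtain ⟨C, hC⟩ := exists_bound_comp_resolventCoord (n := n) ha₀ ha hz hF
  exact .of_bound (hF.comp (continuous_resolventCoord ha₀ ha hz)).aestronglyMeasurable C
    (.of_forall hC)

/-- The master equation. -/
lemma integral_master_eq_zero (hn : n ≠ 0) :
    ∫ y, ((z - a₀) * idTensorTr (resolventCoord a₀ a z y) -
      ∑ i, a i * idTensorTr (resolventCoord a₀ a z y) * a i *
        idTensorTr (resolventCoord a₀ a z y) - 1)
      ∂(gaussianPi (Fin r × (Fin n × Fin n)) (1 / (n : ℝ≥0))) = 0 := by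
  set v : ℝ≥0 := 1 / (n : ℝ≥0) with hv
  have hn' : (n : ℂ) ≠ 0 := by exact_mod_cast hn
  have hv0 : v ≠ 0 := by simp [hv, hn]
  set γ := gaussianPi (Fin r × (Fin n × Fin n)) v with hγ
  set R := resolventCoord (n := n) a₀ a z with hR
  set B : Fin r × (Fin n × Fin n) → Matrix (Fin m × Fin n) (Fin m × Fin n) ℂ :=
    fun t => a t.1 ⊗ₖ saBasis t.2 with hB
  have hRc : Continuous R := continuous_resolventCoord ha₀ ha hz
  have stein : ∀ t, ∫ y, y t • (B t * R y) ∂γ = (v : ℝ) • ∫ y, B t * (R y * B t * R y) ∂γ := by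
    intro t
    obtain ⟨C, hC⟩ := exists_bound_comp_resolventCoord (n := n) ha₀ ha hz
      (F := fun T => B t * T) (by fun_prop)
    obtain ⟨C', hC'⟩ := exists_bound_comp_resolventCoord (n := n) ha₀ ha hz
      (F := fun T => B t * (T * B t * T)) (by fun_prop)
    exact integral_smul_gaussianPi hv0 t
      (fun y s => (hasDerivAt_resolventCoord ha₀ ha hz t y s).const_mul (B t))
      (by fun_prop) (by fun_prop) hC hC'
  have i1 : ∀ t, Integrable (fun y => y t • (B t * R y)) γ := by
    intro t
    obtain ⟨C, hC⟩ := exists_bound_comp_resolventCoord (n := n) ha₀ ha hz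
      (F := fun T => B t * T) (by fun_prop)
    exact integrable_smul_gaussianPi v t (by fun_prop) hC
  have i2 : ∀ t, Integrable (fun y => B t * (R y * B t * R y)) γ := fun t =>
    integrable_comp_resolventCoord ha₀ ha hz v (F := fun T => B t * (T * B t * T)) (by fun_prop)
  have i3 : Integrable (fun y => ((z - a₀) ⊗ₖ (1 : Matrix (Fin n) (Fin n) ℂ)) * R y - 1) γ :=
    integrable_comp_resolventCoord ha₀ ha hz v
      (F := fun T => ((z - a₀) ⊗ₖ (1 : Matrix (Fin n) (Fin n) ℂ)) * T - 1) (by fun_prop)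
  have i2' : Integrable (fun y => (v : ℝ) • ∑ t, B t * (R y * B t * R y)) γ :=
    (integrable_finsetSum _ fun t _ => i2 t).smul (v : ℝ)
  have hpt : ∀ y, ((z - a₀) ⊗ₖ (1 : Matrix (Fin n) (Fin n) ℂ)) * R y - 1 =
      ∑ t, y t • (B t * R y) := by
    intro y
    have h1 : shiftedPencil a₀ a z y * R y = 1 :=
      Matrix.mul_nonsing_inv _ ((Matrix.isUnit_iff_isUnit_det _).1
        (isUnit_shiftedPencil ha₀ ha hz y))
    rw [← h1, shiftedPencil_eq, sub_mul, sub_sub_cancel, Finset.sum_mul]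
    refine Finset.sum_congr rfl fun t _ => ?_
    rw [Matrix.smul_mul]
    rfl
  -- The factor `n` from the completeness relation cancels the variance `1/n`.
  have hpt2 : ∀ y, (v : ℝ) • ∑ t, B t * (R y * B t * R y) =
      (∑ i, (a i * idTensorTr (R y) * a i) ⊗ₖ (1 : Matrix (Fin n) (Fin n) ℂ)) * R y := by
    intro y
    rw [Fintype.sum_prod_type, Finset.sum_mul, Finset.smul_sum]
    refine Finset.sum_congr rfl fun i _ => ?_
    have e : ∑ p, B (i, p) * (R y * B (i, p) * R y) =
        (∑ p, (a i ⊗ₖ saBasis p) * R y * (a i ⊗ₖ saBasis p)) * R y := by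
      rw [Finset.sum_mul]
      exact Finset.sum_congr rfl fun p _ => by simp only [hB, mul_assoc]
    rw [e, sum_kronecker_saBasis_mul_mul _ _ hn, Matrix.smul_mul, hv]
    ext x w
    simp only [Matrix.smul_apply, Complex.real_smul, smul_eq_mul]
    push_cast
    field_simp
  have hI : ∫ y, (((z - a₀) ⊗ₖ (1 : Matrix (Fin n) (Fin n) ℂ)) * R y - 1 -
      (∑ i, (a i * idTensorTr (R y) * a i) ⊗ₖ (1 : Matrix (Fin n) (Fin n) ℂ)) * R y) ∂γ = 0 := by
    simp_rw [← hpt2]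
    rw [integral_sub i3 i2']
    simp_rw [hpt]
    rw [integral_finsetSum _ fun t _ => i1 t, integral_smul, integral_finsetSum _ fun t _ => i2 t,
      Finset.smul_sum, sub_eq_zero]
    exact Finset.sum_congr rfl fun t _ => stein t
  have i4 : Integrable (fun y => ((z - a₀) ⊗ₖ (1 : Matrix (Fin n) (Fin n) ℂ)) * R y - 1 -
      (∑ i, (a i * idTensorTr (R y) * a i) ⊗ₖ (1 : Matrix (Fin n) (Fin n) ℂ)) * R y) γ := by
    simp_rw [← hpt2]
    exact i3.sub i2'
  have h := idTensorTrL.integral_comp_comm i4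
  rw [hI, map_zero] at h
  refine Eq.trans (integral_congr_ae (.of_forall fun y => ?_)) h
  simp only [map_sub, Finset.sum_mul, map_sum, idTensorTrL_apply, idTensorTr_kronecker_one_mul,
    idTensorTr_one hn]
  abel

/-- The variance estimate for the entries of the normalized trace of the resolvent. -/
lemma integral_norm_idTensorTr_sub_sq_le (hn : n ≠ 0) (j k : Fin m) :
    ∫ y, ‖idTensorTr (resolventCoord a₀ a z y) j k -
        ∫ x, idTensorTr (resolventCoord a₀ a z x) j k
          ∂(gaussianPi (Fin r × (Fin n × Fin n)) (1 / (n : ℝ≥0)))‖ ^ 2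
        ∂(gaussianPi (Fin r × (Fin n × Fin n)) (1 / (n : ℝ≥0))) ≤
      m * ‖∑ i, a i ^ 2‖ * ‖(imPart z)⁻¹‖ ^ 4 / (n : ℝ) ^ 2 := by
  set v : ℝ≥0 := 1 / (n : ℝ≥0) with hv
  have hn' : (n : ℝ) ≠ 0 := by exact_mod_cast hn
  have hv0 : v ≠ 0 := by simp [hv, hn]
  set γ := gaussianPi (Fin r × (Fin n × Fin n)) v with hγ
  set R := resolventCoord (n := n) a₀ a z with hR
  set c := ‖(imPart z)⁻¹‖ with hc
  set N := ‖∑ i, a i ^ 2‖ with hN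
  set B : Fin r × (Fin n × Fin n) → Matrix (Fin m × Fin n) (Fin m × Fin n) ℂ :=
    fun t => a t.1 ⊗ₖ saBasis t.2 with hB
  have hRc : Continuous R := continuous_resolventCoord ha₀ ha hz
  set ℓ : Matrix (Fin m × Fin n) (Fin m × Fin n) ℂ →L[ℝ] ℂ := (entryL j k).comp idTensorTrL with hℓ
  have hℓ' : ∀ T, ℓ T = idTensorTr T j k := fun T => rfl
  simp_rw [← hℓ']
  have hF : ∀ t, Continuous fun T : Matrix (Fin m × Fin n) (Fin m × Fin n) ℂ => ℓ (T * B t * T) :=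
    fun t => ℓ.continuous.comp (by fun_prop)
  obtain ⟨C, hC⟩ := exists_bound_comp_resolventCoord (n := n) ha₀ ha hz ℓ.continuous
  choose C' hC' using fun t => exists_bound_comp_resolventCoord (n := n) ha₀ ha hz (hF t)
  -- One bound must serve all partial derivatives at once; the sum of the `|C' t|` does.
  have hP := integral_norm_sub_integral_sq_gaussianPi_le hv0 (f := fun y => ℓ (R y))
    (f' := fun t y => ℓ (R y * B t * R y)) (C := C) (C' := ∑ t, |C' t|)
    (fun t y s => ℓ.hasFDerivAt.comp_hasDerivAt s (hasDerivAt_resolventCoord ha₀ ha hz t y s))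
    (ℓ.continuous.comp hRc) (fun t => (hF t).comp hRc) hC
    (fun t x => (hC' t x).trans ((le_abs_self _).trans
      (Finset.single_le_sum (f := fun t => |C' t|) (fun t _ => abs_nonneg _) (Finset.mem_univ t))))
  refine hP.trans ?_
  have hfrob := sum_frobSq_le ha
  have hpt : ∀ y, ∑ t, ‖ℓ (R y * B t * R y)‖ ^ 2 ≤ m * N * c ^ 4 / n := by
    intro y
    set E := Matrix.single k j (1 : ℂ) ⊗ₖ (1 : Matrix (Fin n) (Fin n) ℂ) with hE
    -- Cyclicity of the trace isolates `B t`, so summing over `t` is a Bessel sum against the fixed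
    -- matrix `R E R`. Its squared Frobenius norm is only of order `n`, against the prefactor `1 / n
    -- ^ 2`; the variance `1/n` in Poincaré brings the total to order `1 / n ^ 2`.
    have hTr : ∀ t, ‖ℓ (R y * B t * R y)‖ ^ 2 =
        1 / (n : ℝ) ^ 2 * ‖(B t * (R y * E * R y)).trace‖ ^ 2 := by
      intro t
      rw [hℓ', idTensorTr_apply_eq_trace, norm_mul, mul_pow, ← hE]
      congr 1
      · simp
      · rw [mul_assoc, mul_assoc, Matrix.trace_mul_comm]
        simp only [mul_assoc]
    have hT : frobSq (R y * E * R y) ≤ c ^ 2 * (c ^ 2 * n) := by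
      have hb := norm_resolventCoord_le (n := n) ha₀ ha hz y
      calc frobSq (R y * E * R y) ≤ ‖R y‖ ^ 2 * frobSq (R y * E) := frobSq_mul_le_right _ _
        _ ≤ ‖R y‖ ^ 2 * (‖R y‖ ^ 2 * frobSq E) :=
            mul_le_mul_of_nonneg_left (frobSq_mul_le_left _ _) (by positivity)
        _ = ‖R y‖ ^ 2 * (‖R y‖ ^ 2 * n) := by rw [frobSq_single_kronecker_one]
        _ ≤ _ := by gcongr
    calc ∑ t, ‖ℓ (R y * B t * R y)‖ ^ 2
        = 1 / (n : ℝ) ^ 2 * ∑ i, ∑ p, ‖((a i ⊗ₖ saBasis p) * (R y * E * R y)).trace‖ ^ 2 := by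
          simp_rw [hTr]
          rw [← Finset.mul_sum, Fintype.sum_prod_type]
      _ ≤ 1 / (n : ℝ) ^ 2 * ∑ i, frobSq (a i) * frobSq (R y * E * R y) := by
          exact mul_le_mul_of_nonneg_left (Finset.sum_le_sum fun i _ =>
            sum_norm_trace_kronecker_mul_sq_le _ _) (by positivity)
      _ ≤ 1 / (n : ℝ) ^ 2 * ((m * N) * (c ^ 2 * (c ^ 2 * n))) := by
          rw [← Finset.sum_mul]
          exact mul_le_mul_of_nonneg_left
            (mul_le_mul hfrob hT (frobSq_nonneg _) (by positivity)) (by positivity)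
      _ = _ := by field_simp
  have hint : ∀ t, Integrable (fun y => ‖ℓ (R y * B t * R y)‖ ^ 2) γ := fun t =>
    integrable_comp_resolventCoord ha₀ ha hz v (F := fun T => ‖ℓ (T * B t * T)‖ ^ 2)
      ((hF t).norm.pow 2)
  rw [← integral_finsetSum _ fun t _ => hint t]
  calc (v : ℝ) * ∫ y, ∑ t, ‖ℓ (R y * B t * R y)‖ ^ 2 ∂γ
      ≤ v * ∫ _y, m * N * c ^ 4 / n ∂γ := by
        exact mul_le_mul_of_nonneg_left (integral_mono
          (integrable_finsetSum _ fun t _ => hint t) (integrable_const _) hpt) v.coe_nonneg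
    _ = _ := by
        have hvr : (v : ℝ) = 1 / n := by rw [hv, NNReal.coe_div, NNReal.coe_one, NNReal.coe_natCast]
        rw [integral_const, probReal_univ, one_smul, hvr]
        ring

/-- The master inequality, for the standard Gaussian coordinates. -/
lemma norm_master_le (hn : n ≠ 0) {G : Matrix (Fin m) (Fin m) ℂ}
    (hG : G = ∫ y, idTensorTr (resolventCoord a₀ a z y)
      ∂(gaussianPi (Fin r × (Fin n × Fin n)) (1 / (n : ℝ≥0)))) :
    ‖∑ i, a i * G * a i * G + (a₀ - z) * G + 1‖ ≤
      ((m : ℝ) ^ 3 * ‖∑ i, a i ^ 2‖ ^ 2) / (n : ℝ) ^ 2 * ‖(imPart z)⁻¹‖ ^ 4 := by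
  set v : ℝ≥0 := 1 / (n : ℝ≥0) with hv
  set γ := gaussianPi (Fin r × (Fin n × Fin n)) v with hγ
  set H : (Fin r × (Fin n × Fin n) → ℝ) → Matrix (Fin m) (Fin m) ℂ :=
    fun y => idTensorTr (resolventCoord a₀ a z y) with hH
  set c := ‖(imPart z)⁻¹‖ with hc
  set N := ‖∑ i, a i ^ 2‖ with hN
  have hHi : Integrable H γ :=
    integrable_comp_resolventCoord ha₀ ha hz v (F := fun T => idTensorTrL T) (by fun_prop)
  have hM := integral_master_eq_zero ha₀ ha hz hn
  -- `Φ` collects the terms linear in `H` when `∑ a i (H - G) a i (H - G)` is expanded and the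
  -- integrand of the master equation is split off. Its expectation is `Φ G`, and the master
  -- equation removes the quadratic term.
  set Φ : Matrix (Fin m) (Fin m) ℂ →L[ℝ] Matrix (Fin m) (Fin m) ℂ :=
    LinearMap.toContinuousLinearMap
      { toFun := fun X => (z - a₀) * X - ∑ i, a i * G * a i * X - ∑ i, a i * X * a i * G
        map_add' := fun X Y => by
          simp only [mul_add, add_mul, Finset.sum_add_distrib]; abel
        map_smul' := fun s X => by
          simp only [mul_smul_comm, smul_mul_assoc, ← Finset.smul_sum, smul_sub, RingHom.id_apply] }
    with hΦ
  have hΦ' : ∀ X, Φ X =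
      (z - a₀) * X - ∑ i, a i * G * a i * X - ∑ i, a i * X * a i * G := fun X => rfl
  have hΦi := Φ.integrable_comp hHi
  have hMi : Integrable (fun y => (z - a₀) * H y - ∑ i, a i * H y * a i * H y - 1) γ :=
    integrable_comp_resolventCoord ha₀ ha hz v (F := fun T => (z - a₀) * idTensorTrL T -
      ∑ i, a i * idTensorTrL T * a i * idTensorTrL T - 1) (by fun_prop)
  have hΦMi : Integrable
      (fun y => Φ (H y) - ((z - a₀) * H y - ∑ i, a i * H y * a i * H y - 1)) γ := hΦi.sub hMi
  have hpt : ∀ y, ∑ i, a i * (H y - G) * a i * (H y - G) =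
      Φ (H y) - ((z - a₀) * H y - ∑ i, a i * H y * a i * H y - 1) +
        (∑ i, a i * G * a i * G - 1) := by
    intro y
    have : ∀ i, a i * (H y - G) * a i * (H y - G) = a i * H y * a i * H y -
        a i * G * a i * H y - a i * H y * a i * G + a i * G * a i * G := fun i => by
      noncomm_ring
    simp_rw [this, Finset.sum_add_distrib, Finset.sum_sub_distrib, hΦ']
    abel
  have hmain : ∑ i, a i * G * a i * G + (a₀ - z) * G + 1 =
      -∫ y, ∑ i, a i * (H y - G) * a i * (H y - G) ∂γ := by
    simp_rw [hpt]
    rw [integral_add hΦMi (integrable_const _), integral_sub hΦi hMi, hM,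
      Φ.integral_comp_comm hHi, ← hG, hΦ', integral_const]
    simp only [probReal_univ, one_smul, sub_mul]
    abel
  rw [hmain, norm_neg]
  have hfi : ∀ j k, Integrable (fun y => ‖H y j k - G j k‖ ^ 2) γ := fun j k =>
    integrable_comp_resolventCoord ha₀ ha hz v
      (F := fun T => ‖(entryL j k) (idTensorTrL T) - G j k‖ ^ 2) (by fun_prop)
  have hGe : ∀ j k, G j k = ∫ y, H y j k ∂γ := fun j k => by
    rw [hG]
    exact ((entryL j k).integral_comp_comm hHi).symm
  calc ‖∫ y, ∑ i, a i * (H y - G) * a i * (H y - G) ∂γ‖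
      ≤ ∫ y, N * ∑ j, ∑ k, ‖H y j k - G j k‖ ^ 2 ∂γ := by
        refine norm_integral_le_of_norm_le ?_ (.of_forall fun y => ?_)
        · exact (integrable_finsetSum _ fun j _ =>
            integrable_finsetSum _ fun k _ => hfi j k).const_mul _
        · rw [← Finset.sum_mul]
          calc _ ≤ ‖∑ i, a i * (H y - G) * a i‖ * ‖H y - G‖ := norm_mul_le _ _
            _ ≤ (N * ‖H y - G‖) * ‖H y - G‖ := by
                exact mul_le_mul_of_nonneg_right (norm_sum_mul_mul_le ha _) (norm_nonneg _)
            _ = N * ‖H y - G‖ ^ 2 := by ring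
            _ ≤ _ := by
                exact mul_le_mul_of_nonneg_left (l2_opNorm_sq_le_frobSq (H y - G))
                  (norm_nonneg _)
    _ = N * ∑ j, ∑ k, ∫ y, ‖H y j k - G j k‖ ^ 2 ∂γ := by
        rw [integral_const_mul, integral_finsetSum _ fun j _ =>
          integrable_finsetSum _ fun k _ => hfi j k]
        congr 1
        exact Finset.sum_congr rfl fun j _ => integral_finsetSum _ fun k _ => hfi j k
    _ ≤ N * ∑ _j : Fin m, ∑ _k : Fin m, (m * N * c ^ 4 / (n : ℝ) ^ 2) := by
        refine mul_le_mul_of_nonneg_left (Finset.sum_le_sum fun j _ =>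
          Finset.sum_le_sum fun k _ => ?_) (norm_nonneg _)
        rw [hGe]
        exact integral_norm_idTensorTr_sub_sq_le ha₀ ha hz hn j k
    _ = _ := by
        simp only [Finset.sum_const, Finset.card_univ, Fintype.card_fin, nsmul_eq_mul]
        ring

end MasterEquation

/-! ### The joint law of the coordinates -/

section Law

variable {Ω : Type*} [MeasurableSpace Ω] {P : Measure Ω} {n r : ℕ}

lemma measurable_saCoord (p : Fin n × Fin n) :
    Measurable fun A : Matrix (Fin n) (Fin n) ℂ => saCoord A p := by
  have h : ∀ k l, Measurable fun A : Matrix (Fin n) (Fin n) ℂ => A k l := fun k l =>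
    (measurable_pi_apply l).comp (measurable_pi_apply (X := fun _ : Fin n => Fin n → ℂ) k)
  unfold saCoord
  split_ifs
  · exact Complex.measurable_re.comp (h _ _)
  · exact (Complex.measurable_re.comp (h _ _)).const_mul _
  · exact (Complex.measurable_im.comp (h _ _)).const_mul _

/-- The joint law of the coordinates of independent `SGRM` matrices. -/
lemma hasLaw_saCoord [IsProbabilityMeasure P] {v : ℝ≥0}
    {X : Fin r → Ω → Matrix (Fin n) (Fin n) ℂ} (hX : ∀ i, IsSGRM P n v (X i))
    (hindep : iIndepFun X P) :
    HasLaw (fun ω (t : Fin r × (Fin n × Fin n)) => saCoord (X t.1 ω) t.2)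
      (gaussianPi (Fin r × (Fin n × Fin n)) v) P := by
  refine iIndepFun.hasLaw_pi (μ := fun _ => gaussianReal 0 v)
    (X := fun (t : Fin r × (Fin n × Fin n)) ω => saCoord (X t.1 ω) t.2)
    (fun t => (hX t.1).hasLaw_coord t.2) ?_
  refine iIndepFun_uncurry' (X := fun i p ω => saCoord (X i ω) p)
    (fun i p => (measurable_saCoord p).comp (hX i).measurable) ?_
    (fun i => (hX i).iIndepFun_coord)
  exact hindep.comp (fun _ A p => saCoord A p) fun _ => measurable_pi_iff.2 measurable_saCoord

end Law

end MasterInequality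

/-! ### Transfer to the given probability space -/

theorem theorem4p5 {Ω : Type*} [MeasurableSpace Ω] (P : Measure Ω) [IsProbabilityMeasure P]
    (m n r : ℕ) (hn : 0 < n)
    (a₀ : Matrix (Fin m) (Fin m) ℂ) (a : Fin r → Matrix (Fin m) (Fin m) ℂ)
    (ha₀ : a₀.IsHermitian) (ha : ∀ i, (a i).IsHermitian)
    (X : Fin r → Ω → Matrix (Fin n) (Fin n) ℂ)
    (hX : ∀ i, MasterInequality.IsSGRM P n (1 / (n : ℝ≥0)) (X i))
    (hindep : iIndepFun X P)
    (z : Matrix (Fin m) (Fin m) ℂ) (hz : (MasterInequality.imPart z).PosDef) :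
    (∀ ω, IsUnit (z ⊗ₖ (1 : Matrix (Fin n) (Fin n) ℂ)
      - MasterInequality.linPencil a₀ a (fun i => X i ω))) ∧
    Integrable (fun ω => MasterInequality.resolventTr a₀ a z (fun i => X i ω)) P ∧
    ‖∑ i, a i * MasterInequality.meanResolventTr P a₀ a X z
          * a i * MasterInequality.meanResolventTr P a₀ a X z
        + (a₀ - z) * MasterInequality.meanResolventTr P a₀ a X z + 1‖
      ≤ ((m : ℝ) ^ 3 * ‖∑ i, a i ^ 2‖ ^ 2) / (n : ℝ) ^ 2
        * ‖(MasterInequality.imPart z)⁻¹‖ ^ 4 := by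
  open MasterInequality in
  have hlaw := hasLaw_saCoord hX hindep
  -- Self-adjointness at every sample point makes the resolvent trace a function of the coordinate
  -- vector, so integrability and expectation can be computed under its Gaussian law.
  have hpt : ∀ ω, resolventTr a₀ a z (fun i => X i ω) =
      idTensorTr (resolventCoord a₀ a z fun t => saCoord (X t.1 ω) t.2) := by
    intro ω
    have : (fun i => X i ω) = ofCoord fun t => saCoord (X t.1 ω) t.2 :=
      funext fun i => (sum_saCoord_smul_saBasis ((hX i).isHermitian ω)).symm
    rw [resolventTr, this]
    rfl
  have hint : Integrable (fun y => idTensorTr (resolventCoord a₀ a z y))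
      (gaussianPi (Fin r × (Fin n × Fin n)) (1 / (n : ℝ≥0))) :=
    integrable_comp_resolventCoord ha₀ ha hz _ (F := fun T => idTensorTrL T) (by fun_prop)
  refine ⟨fun ω => (isUnit_and_norm_resolvent_le hz
    (isHermitian_linPencil ha₀ ha fun i => (hX i).isHermitian ω)).1, ?_, ?_⟩
  · simp_rw [hpt]
    rw [← hlaw.map_eq] at hint
    exact hint.comp_aemeasurable hlaw.aemeasurable
  · refine norm_master_le ha₀ ha hz hn.ne' ?_
    rw [meanResolventTr]
    simp_rw [hpt]
    exact hlaw.integral_comp hint.aestronglyMeasurable
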